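/- Let $(M,g)$ be a smooth Lorentzian manifold of signature $(-,+,\dots,+)$ with Ricci tensor $R_{ij}$. Suppose that: (i) $(M,g)$ is generalized quasi-Einstein: there are real constants $\alpha,\beta,\gamma$ and smooth space-like orthonormal vector fields $A,B$ (that is, $A_iA^i=B_iB^i=1$ and $A_iB^i=0$) such that $$R_{ij}=\alpha g_{ij}+\beta A_iA_j+\gamma\,(A_iB_j+A_jB_i);$$ (ii) $M$ admits a unit time-like nontrivial torse-forming vector field which is an eigenvector of the Ricci tensor: a smooth vector field $u$ with $u_iu^i=-1$, together with smooth functions $\varphi,\xi$ on $M$, such that $$\nabla_k u_j=\varphi\,(g_{kj}+u_ku_j),\qquad u^iR_{ij}=\xi u_j,$$ and $\varphi$ is not identically zero. Then $(M,g)$ is either an Einstein GRW space-time or a perfect fluid GRW space-time (the two alternatives are not meant to be exclusive). Here *Einstein* means $R_{ij}=c\,g_{ij}$ for a constant $c$; *perfect fluid* means $R_{ij}=a\,g_{ij}+b\,V_iV_j$ for smooth functions $a,b$ and a smooth unit time-like vector field $V$; and *GRW (generalized Robertson-Walker) space-time* means that every point of $M$ has an open neighbourhood isometric to a warped product $J\times_f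 M^*$, i.e. to $J\times M^*$ with the metric $-dt^2+f(t)^2h$, where $J\subset\mathbb{R}$ is an open interval, $f:J\to(0,\infty)$ is smooth and $(M^*,h)$ is a Riemannian manifold. -/

import Mathlib

open scoped Manifold ContDiff

noncomputable section

namespace GRW

/-- Model space of an `(m + 1)`-dimensional space-time; the coordinates are indexed by
`Fin (m + 1)`. -/
abbrev Model (m : ℕ) : Type := EuclideanSpace ℝ (Fin (m + 1))

variable {m : ℕ} {M : Type*} [TopologicalSpace M] [ChartedSpace (Model m) M]

/-- The smooth charts (local coordinate systems) of `M`. -/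
def charts (m : ℕ) (M : Type*) [TopologicalSpace M] [ChartedSpace (Model m) M] :
    Set (OpenPartialHomeomorph M (Model m)) :=
  IsManifold.maximalAtlas 𝓘(ℝ, Model m) ∞ M

/-- The `i`-th standard basis vector of the model space. -/
def stdVec (i : Fin (m + 1)) : Model m := EuclideanSpace.single i (1 : ℝ)

/-- The partial derivative `∂ᵢ F` of a function of the coordinates. -/
def pd (i : Fin (m + 1)) (F : Model m → ℝ) (y : Model m) : ℝ := fderiv ℝ F y (stdVec i)

/-- A smooth Lorentzian metric, of signature `(-, +, …, +)`: at each point a symmetric bilinear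
form which is negative on some vector `τ` and positive definite on the orthogonal complement
of `τ`. -/
structure LorentzMetric (m : ℕ) (M : Type*) [TopologicalSpace M] [ChartedSpace (Model m) M]
    [IsManifold 𝓘(ℝ, Model m) ∞ M] where
  /-- the bilinear form on each tangent space -/
  val : ∀ p : M, TangentSpace 𝓘(ℝ, Model m) p →L[ℝ] TangentSpace 𝓘(ℝ, Model m) p →L[ℝ] ℝ
  symm' : ∀ (p : M) (v w : TangentSpace 𝓘(ℝ, Model m) p), val p v w = val p w v
  lorentz : ∀ p : M, ∃ τ : TangentSpace 𝓘(ℝ, Model m) p, val p τ τ < 0 ∧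
    ∀ w : TangentSpace 𝓘(ℝ, Model m) p, val p τ w = 0 → w ≠ 0 → 0 < val p w w
  smooth : ContMDiff 𝓘(ℝ, Model m)
    (𝓘(ℝ, Model m).prod 𝓘(ℝ, Model m →L[ℝ] Model m →L[ℝ] ℝ)) ∞
    (fun p : M => Bundle.TotalSpace.mk' (Model m →L[ℝ] Model m →L[ℝ] ℝ)
      (E := fun p : M =>
        TangentSpace 𝓘(ℝ, Model m) p →L[ℝ] TangentSpace 𝓘(ℝ, Model m) p →L[ℝ] ℝ) p (val p))

/-- A vector field on `M` (smoothness is the separate predicate `IsSmoothField`). -/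
abbrev Field (m : ℕ) (M : Type*) [TopologicalSpace M] [ChartedSpace (Model m) M] : Type _ :=
  ∀ p : M, TangentSpace 𝓘(ℝ, Model m) p

/-- Smoothness of a vector field. -/
def IsSmoothField [IsManifold 𝓘(ℝ, Model m) ∞ M] (X : Field m M) : Prop :=
  ContMDiff 𝓘(ℝ, Model m) 𝓘(ℝ, Model m).tangent ∞
    (fun p : M => (⟨p, X p⟩ : TangentBundle 𝓘(ℝ, Model m) M))

/-- A smooth real function on `M`. -/
def IsSmoothFun (f : M → ℝ) : Prop := ContMDiff 𝓘(ℝ, Model m) 𝓘(ℝ, ℝ) ∞ f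

/-- The coordinate vector field `∂ᵢ` of the chart `e`, at the point with coordinates `y`. -/
def coordVec (e : OpenPartialHomeomorph M (Model m)) (y : Model m) (i : Fin (m + 1)) :
    TangentSpace 𝓘(ℝ, Model m) (e.symm y) :=
  mfderiv 𝓘(ℝ, Model m) 𝓘(ℝ, Model m) e.symm y (stdVec i : Model m)

section Curvature

/-- The Christoffel symbols `Γᵏᵢⱼ = ½ gᵏˡ (∂ᵢ gₗⱼ + ∂ⱼ gₗᵢ - ∂ₗ gᵢⱼ)` of a matrix `G` of metric
components. -/
def christoffel (G : Model m → Matrix (Fin (m + 1)) (Fin (m + 1)) ℝ)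
    (k i j : Fin (m + 1)) (y : Model m) : ℝ :=
  (1 / 2 : ℝ) * ∑ l, (G y)⁻¹ k l *
    (pd i (fun z => G z l j) y + pd j (fun z => G z l i) y - pd l (fun z => G z i j) y)

/-- The Ricci tensor
`Rᵢⱼ = ∂ₖ Γᵏᵢⱼ - ∂ⱼ Γᵏᵢₖ + Γᵏₖₗ Γˡᵢⱼ - Γᵏⱼₗ Γˡᵢₖ` of a matrix `G` of metric components. -/
def ricciOf (G : Model m → Matrix (Fin (m + 1)) (Fin (m + 1)) ℝ)
    (i j : Fin (m + 1)) (y : Model m) : ℝ :=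
  ∑ k, (pd k (christoffel G k i j) y - pd j (christoffel G k i k) y) +
    ∑ k, ∑ l, (christoffel G k k l y * christoffel G l i j y -
      christoffel G k j l y * christoffel G l i k y)

end Curvature

variable [IsManifold 𝓘(ℝ, Model m) ∞ M]

/-- The matrix of components `gᵢⱼ` of the metric in the chart `e`, as a function of the
coordinates. -/
def LorentzMetric.comp (g : LorentzMetric m M) (e : OpenPartialHomeomorph M (Model m))
    (y : Model m) : Matrix (Fin (m + 1)) (Fin (m + 1)) ℝ :=
  Matrix.of fun i j => g.val (e.symm y) (coordVec e y i) (coordVec e y j)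

/-- The components `Xᵢ = g(X, ∂ᵢ)`, in the chart `e`, of the 1-form metrically equivalent to the
vector field `X`. -/
def LorentzMetric.lower (g : LorentzMetric m M) (X : Field m M)
    (e : OpenPartialHomeomorph M (Model m)) (i : Fin (m + 1)) (y : Model m) : ℝ :=
  g.val (e.symm y) (X (e.symm y)) (coordVec e y i)

/-- The contravariant components `Xⁱ = gⁱˡ Xₗ` of the vector field `X` in the chart `e`. -/
def LorentzMetric.upper (g : LorentzMetric m M) (X : Field m M)
    (e : OpenPartialHomeomorph M (Model m)) (i : Fin (m + 1)) (y : Model m) : ℝ :=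
  ∑ l, (g.comp e y)⁻¹ i l * g.lower X e l y

/-- The components `∇ₖ Xⱼ = ∂ₖ Xⱼ - Γˡₖⱼ Xₗ` of the Levi-Civita covariant derivative of `X`. -/
def LorentzMetric.nabla (g : LorentzMetric m M) (X : Field m M)
    (e : OpenPartialHomeomorph M (Model m)) (k j : Fin (m + 1)) (y : Model m) : ℝ :=
  pd k (g.lower X e j) y - ∑ l, christoffel (g.comp e) l k j y * g.lower X e l y

/-- The components `Rᵢⱼ` of the Ricci tensor of `g` in the chart `e`. -/
def LorentzMetric.ricci (g : LorentzMetric m M) (e : OpenPartialHomeomorph M (Model m))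
    (i j : Fin (m + 1)) (y : Model m) : ℝ :=
  ricciOf (g.comp e) i j y

/-- A smooth unit time-like vector field. -/
def IsUnitTimelike (g : LorentzMetric m M) (u : Field m M) : Prop :=
  IsSmoothField u ∧ ∀ p, g.val p (u p) (u p) = -1

/-- Two smooth orthonormal (space-like) vector fields. -/
def IsOrthonormalPair (g : LorentzMetric m M) (A B : Field m M) : Prop :=
  IsSmoothField A ∧ IsSmoothField B ∧ (∀ p, g.val p (A p) (A p) = 1) ∧
    (∀ p, g.val p (B p) (B p) = 1) ∧ ∀ p, g.val p (A p) (B p) = 0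

/-- `(M, g)` is generalized quasi-Einstein: for constants `α, β, γ` and the 1-forms metrically
equivalent to two orthonormal vector fields `A, B`,
`Rᵢⱼ = α gᵢⱼ + β Aᵢ Aⱼ + γ (Aᵢ Bⱼ + Aⱼ Bᵢ)`. -/
def IsGeneralizedQuasiEinstein (g : LorentzMetric m M) : Prop :=
  ∃ (α β γ : ℝ) (A B : Field m M), IsOrthonormalPair g A B ∧
    ∀ e ∈ charts m M, ∀ y ∈ e.target, ∀ i j : Fin (m + 1),
      g.ricci e i j y = α * g.comp e y i j + β * (g.lower A e i y * g.lower A e j y) +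
        γ * (g.lower A e i y * g.lower B e j y + g.lower A e j y * g.lower B e i y)

/-- `∇ₖ uⱼ = φ (gₖⱼ + uₖ uⱼ)`: the torse-forming equation for a unit time-like field. -/
def IsTorseForming (g : LorentzMetric m M) (u : Field m M) (φ : M → ℝ) : Prop :=
  ∀ e ∈ charts m M, ∀ y ∈ e.target, ∀ k j : Fin (m + 1),
    g.nabla u e k j y = φ (e.symm y) * (g.comp e y k j + g.lower u e k y * g.lower u e j y)

/-- `uⁱ Rᵢⱼ = ξ uⱼ`: the field `u` is an eigenvector of the Ricci tensor. -/
def IsRicciEigenvector (g : LorentzMetric m M) (u : Field m M) (ξ : M → ℝ) : Prop :=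
  ∀ e ∈ charts m M, ∀ y ∈ e.target, ∀ j : Fin (m + 1),
    ∑ i, g.upper u e i y * g.ricci e i j y = ξ (e.symm y) * g.lower u e j y

/-- `(M, g)` admits a unit time-like nontrivial torse-forming vector field: a smooth unit
time-like field `u` with `∇ₖ uⱼ = φ (gₖⱼ + uₖ uⱼ)` which is an eigenvector of the Ricci tensor,
`φ` not being identically zero. -/
def AdmitsNontrivialTorseForming (g : LorentzMetric m M) : Prop :=
  ∃ (u : Field m M) (φ ξ : M → ℝ), IsUnitTimelike g u ∧ IsSmoothFun (m := m) φ ∧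
    IsSmoothFun (m := m) ξ ∧ IsTorseForming g u φ ∧ IsRicciEigenvector g u ξ ∧ φ ≠ 0

/-- `(M, g)` is Einstein. -/
def IsEinstein (g : LorentzMetric m M) : Prop :=
  ∃ c : ℝ, ∀ e ∈ charts m M, ∀ y ∈ e.target, ∀ i j : Fin (m + 1),
    g.ricci e i j y = c * g.comp e y i j

/-- `(M, g)` is a perfect fluid space-time: `Rᵢⱼ = a gᵢⱼ + b Vᵢ Vⱼ` for smooth scalars `a, b` and
the 1-form metrically equivalent to a unit time-like vector field `V`. -/
def IsPerfectFluid (g : LorentzMetric m M) : Prop :=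
  ∃ (a b : M → ℝ) (V : Field m M), IsSmoothFun (m := m) a ∧ IsSmoothFun (m := m) b ∧
    IsUnitTimelike g V ∧
    ∀ e ∈ charts m M, ∀ y ∈ e.target, ∀ i j : Fin (m + 1),
      g.ricci e i j y =
        a (e.symm y) * g.comp e y i j + b (e.symm y) * (g.lower V e i y * g.lower V e j y)

/-- The space coordinates `(y₁, …, yₘ)` of `y = (y₀, y₁, …, yₘ)`. -/
def spacePart (y : Model m) : EuclideanSpace ℝ (Fin m) := WithLp.toLp 2 fun a => y a.succ

/-- `(M, g)` is a generalized Robertson-Walker space-time (locally): each point has a neighbourhood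
isometric to a warped product `J ×_f V`, where `J` is an open interval with metric `-dt²`, the fibre
`V` is an open subset of `ℝᵐ` with a smooth Riemannian metric `h`, and `f` is a smooth positive
function on `J`. The isometry is given as a chart with image `J × V` in which
`g = -dt² + f(t)² hₐᵦ dxᵃ dxᵇ`. -/
def IsGRW (g : LorentzMetric m M) : Prop :=
  ∀ p : M, ∃ e ∈ charts m M, p ∈ e.source ∧
    ∃ (t₁ t₂ : ℝ) (V : Set (EuclideanSpace ℝ (Fin m))) (f : ℝ → ℝ)
      (h : EuclideanSpace ℝ (Fin m) → Matrix (Fin m) (Fin m) ℝ),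
      IsOpen V ∧ e.target = {y | y 0 ∈ Set.Ioo t₁ t₂ ∧ spacePart y ∈ V} ∧
      ContDiffOn ℝ ∞ f (Set.Ioo t₁ t₂) ∧ (∀ t ∈ Set.Ioo t₁ t₂, 0 < f t) ∧
      (∀ a b, ContDiffOn ℝ ∞ (fun x => h x a b) V) ∧ (∀ x ∈ V, (h x).PosDef) ∧
      ∀ y ∈ e.target, g.comp e y 0 0 = -1 ∧
        (∀ a : Fin m, g.comp e y 0 a.succ = 0 ∧ g.comp e y a.succ 0 = 0) ∧
        ∀ a b : Fin m, g.comp e y a.succ b.succ = f (y 0) ^ 2 * h (spacePart y) a b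

end GRW

end

/-! The Einstein alternative always holds: a nonzero value of `φ` at a single point forces `β = γ =
0`. Since `∇u` is symmetric, the 1-form dual to `u` is closed. Near any point there are therefore
coordinates in which `u = ∂ₜ` and the metric is `-dt² + g_ab dxᵃ dxᵇ` (`exists_adapted_chart`).
There the torse-forming equation reads `∂ₜ g_ab = 2 φ g_ab`, and the Ricci component `R_0a = (1 - m)
∂_a φ` vanishes because `u` is a Ricci eigenvector. The orthonormal pair and `u` give `m ≥ 2`, so
`φ` depends on `t` only, and integrating gives `g_ab = f(t)² h_ab` with `f'/f = φ`. This is the GRW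
property (`isGRW_of_torseForming`).

Write the Ricci tensor as `α g + T` with `T = β A ⊗ A + γ (A ⊗ B + B ⊗ A)`. The field `u` is an
eigenvector of `T`, and a sum of squares shows that the eigenvalue is zero
(`quasiTensor_eigenvalue_eq_zero`), so `T` is purely spatial. The `tt` component then gives `m (φ' +
φ²) = α`, and with it the spatial components show that `T_ab` does not depend on `t`
(`static_of_ricci_eq`). Hence the trace of `(g⁻¹ T)²` is proportional to `f⁻⁴` along each time line
(`trace_sq_scaling`). Orthonormality makes the same trace equal to the constant `β² + 2γ²`
(`trace_sq_quasiTensor`). If this constant is nonzero, `f` is constant and `φ = 0`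
(`phi_eq_zero_of_quasiEinstein`), at every point.

The analytic input is a flow box that straightens `u` and its dual form together. It rests on smooth
dependence of flows on initial data, obtained from the inverse function theorem in a Banach space of
curves. -/

namespace GRW

open scoped Topology
open Set Filter

/-! ### Superposition operators on spaces of continuous maps, and the smooth inverse function
theorem. -/

section Superposition

variable {X E F : Type*} [TopologicalSpace X] [CompactSpace X]
  [NormedAddCommGroup E] [NormedSpace ℝ E] [NormedAddCommGroup F] [NormedSpace ℝ F]

/-- Pointwise application `(A, h) ↦ (x ↦ A x (h x))` as a continuous bilinear map. -/
noncomputable def pointwiseApply (X E F : Type*) [TopologicalSpace X] [CompactSpace X]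
    [NormedAddCommGroup E] [NormedSpace ℝ E] [NormedAddCommGroup F] [NormedSpace ℝ F] :
    C(X, E →L[ℝ] F) →L[ℝ] C(X, E) →L[ℝ] C(X, F) :=
  LinearMap.mkContinuous₂
    (LinearMap.mk₂ ℝ (fun (A : C(X, E →L[ℝ] F)) (h : C(X, E)) =>
        (⟨fun x => A x (h x), A.continuous.clm_apply h.continuous⟩ : C(X, F)))
      (fun A A' h => by ext; simp) (fun c A h => by ext; simp)
      (fun A h h' => by ext; simp) (fun c A h => by ext; simp)) 1
    (fun A h => by
      rw [ContinuousMap.norm_le _ (by positivity)]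
      intro x
      simp only [LinearMap.mk₂_apply, ContinuousMap.coe_mk, one_mul]
      exact (A x).le_of_opNorm_le_of_le (A.norm_coe_le_norm x) (h.norm_coe_le_norm x))

@[simp] lemma pointwiseApply_apply (A : C(X, E →L[ℝ] F)) (h : C(X, E)) (x : X) :
    pointwiseApply X E F A h x = A x (h x) := rfl

/-- The range of `γ` is compact, so `f'` is continuous there with a uniform modulus. The mean value
inequality then bounds the remainder by the same `c` at all points `x`, which is what the sup norm
requires. -/
lemma hasFDerivAt_postcomp {f : E → F} {f' : E → E →L[ℝ] F} (hf : ∀ x, HasFDerivAt f (f' x) x)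
    (hc : Continuous f) (hc' : Continuous f') (γ : C(X, E)) :
    HasFDerivAt (fun γ : C(X, E) => (⟨f, hc⟩ : C(E, F)).comp γ)
      (pointwiseApply X E F ((⟨f', hc'⟩ : C(E, E →L[ℝ] F)).comp γ)) γ := by
  rw [hasFDerivAt_iff_isLittleO, Asymptotics.isLittleO_iff]
  intro c hcpos
  have hK : IsCompact (range γ) := isCompact_range γ.continuous
  have hU := hK.uniformContinuousAt_of_continuousAt f' (fun a _ => hc'.continuousAt)
    (Metric.dist_mem_uniformity hcpos)
  obtain ⟨δ, hδ, hδU⟩ := Metric.mem_uniformity_dist.1 hU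
  filter_upwards [Metric.ball_mem_nhds γ hδ] with η hη
  rw [ContinuousMap.norm_le _ (by positivity)]
  intro x
  have hx : dist (η x) (γ x) < δ := lt_of_le_of_lt (ContinuousMap.dist_apply_le_dist x) hη
  have key := (convex_ball (γ x) δ).norm_image_sub_le_of_norm_hasFDerivWithin_le'
    (f := f) (f' := f') (φ := f' (γ x)) (C := c) (x := γ x) (y := η x)
    (fun z _ => (hf z).hasFDerivWithinAt)
    (fun z hz => by
      have := hδU (a := γ x) (b := z) (by rw [dist_comm]; exact hz) (mem_range_self x)
      simp only [mem_ofPred_eq] at this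
      rw [← dist_eq_norm, dist_comm]
      exact this.le)
    (Metric.mem_ball_self hδ) hx
  simp only [ContinuousMap.coe_sub, Pi.sub_apply, ContinuousMap.comp_apply, ContinuousMap.coe_mk,
    pointwiseApply_apply]
  refine key.trans ?_
  gcongr
  exact (η - γ).norm_coe_le_norm x

end Superposition

universe v

/-- The derivative of postcomposition by `f` is postcomposition by `f'` followed by a continuous
linear map, so one derivative is gained per induction step. The target changes from `F` to `E →L[ℝ]
F`, hence the quantification over `F` inside the induction and the common universe of `E` and `F`.
-/
lemma contDiff_postcomp_nat {X : Type*} {E : Type v} [TopologicalSpace X] [CompactSpace X]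
    [NormedAddCommGroup E] [NormedSpace ℝ E] (n : ℕ) :
    ∀ {F : Type v} [NormedAddCommGroup F] [NormedSpace ℝ F]
    {f : E → F} (_ : ContDiff ℝ n f) (hc : Continuous f),
    ContDiff ℝ n (fun γ : C(X, E) => (⟨f, hc⟩ : C(E, F)).comp γ) := by
  induction n with
  | zero =>
    intro F _ _ f _ hc
    exact contDiff_zero.2 (ContinuousMap.continuous_postcomp _)
  | succ n ih =>
    intro F _ _ f hf hc
    push_cast at hf ⊢
    obtain ⟨f', hf', hd⟩ := contDiff_succ_iff_hasFDerivAt.1 hf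
    exact contDiff_succ_iff_hasFDerivAt.2
      ⟨_, (pointwiseApply X E F).contDiff.comp (ih hf' hf'.continuous),
        hasFDerivAt_postcomp hd hc hf'.continuous⟩

/-- The superposition operator of a smooth map is smooth on spaces of continuous maps. -/
lemma contDiff_postcomp {X : Type*} {E F : Type v} [TopologicalSpace X] [CompactSpace X]
    [NormedAddCommGroup E] [NormedSpace ℝ E] [NormedAddCommGroup F] [NormedSpace ℝ F]
    {f : E → F} (hf : ContDiff ℝ ∞ f) (hc : Continuous f) :
    ContDiff ℝ ∞ (fun γ : C(X, E) => (⟨f, hc⟩ : C(E, F)).comp γ) :=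
  contDiff_infty.2 fun n => contDiff_postcomp_nat n (contDiff_infty.1 hf n) hc

/-- The inverse function theorem, with smoothness of the inverse on a whole neighbourhood. -/
lemma exists_openPartialHomeomorph_of_contDiffOn {E F : Type*} [NormedAddCommGroup E]
    [NormedSpace ℝ E] [NormedAddCommGroup F] [NormedSpace ℝ F] [CompleteSpace E]
    {f : E → F} {s : Set E} (hs : IsOpen s) (hf : ContDiffOn ℝ ∞ f s) {a : E} (ha : a ∈ s)
    (f' : E ≃L[ℝ] F) (hf' : HasFDerivAt f (f' : E →L[ℝ] F) a) :
    ∃ e : OpenPartialHomeomorph E F, a ∈ e.source ∧ e.source ⊆ s ∧ (e : E → F) = f ∧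
      ContDiffOn ℝ ∞ e.symm e.target := by
  have hfa : ContDiffAt ℝ ∞ f a := hf.contDiffAt (hs.mem_nhds ha)
  have hne : (∞ : WithTop ℕ∞) ≠ 0 := by simp
  set e₀ := hfa.toOpenPartialHomeomorph f hf' hne with he₀
  have hcont : ContinuousOn (fderiv ℝ f) s := hf.continuousOn_fderiv_of_isOpen hs (by simp)
  -- Invertible operators form an open set, so the derivative stays invertible near `a`. Restricting
  -- to these points makes the inverse smooth on the whole target, not only at `f a`.
  set t : Set E := s ∩ fderiv ℝ f ⁻¹' (range ((↑) : (E ≃L[ℝ] F) → E →L[ℝ] F)) with ht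
  have hto : IsOpen t := hcont.isOpen_inter_preimage hs ContinuousLinearEquiv.isOpen
  refine ⟨e₀.restrOpen t hto, ?_, ?_, rfl, ?_⟩
  · exact ⟨hfa.mem_toOpenPartialHomeomorph_source hf' hne, ha, f', hf'.fderiv.symm⟩
  · rintro x ⟨_, hx, _⟩; exact hx
  · intro y hy
    have hx := (e₀.restrOpen t hto).map_target hy
    obtain ⟨hx0, hxs, g, hg⟩ := hx
    refine ContDiffAt.contDiffWithinAt ?_
    refine OpenPartialHomeomorph.contDiffAt_symm _ hy (f₀' := g) ?_ ?_
    · rw [hg]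
      exact ((hf.contDiffAt (hs.mem_nhds hxs)).differentiableAt (by simp)).hasFDerivAt
    · exact hf.contDiffAt (hs.mem_nhds hxs)

/-! ### Smooth dependence of flows on time and initial point. -/

section Flow

variable {E : Type v} [NormedAddCommGroup E]

/-- Extension of a continuous curve on `[-1, 1]` to the real line. -/
noncomputable def extendCurve (γ : C(Icc (-1 : ℝ) 1, E)) : ℝ → E :=
  IccExtend (by norm_num) γ

lemma continuous_extendCurve (γ : C(Icc (-1 : ℝ) 1, E)) : Continuous (extendCurve γ) :=
  γ.continuous.Icc_extend'

lemma extendCurve_coe (γ : C(Icc (-1 : ℝ) 1, E)) (s : Icc (-1 : ℝ) 1) :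
    extendCurve γ s = γ s := IccExtend_val _ _ _

lemma norm_extendCurve_le (γ : C(Icc (-1 : ℝ) 1, E)) (s : ℝ) : ‖extendCurve γ s‖ ≤ ‖γ‖ :=
  γ.norm_coe_le_norm _

variable [NormedSpace ℝ E]

/-- Integration of continuous curves, from the time `0`. -/
noncomputable def integrateCurve (E : Type v) [NormedAddCommGroup E] [NormedSpace ℝ E]
    [CompleteSpace E] :
    C(Icc (-1 : ℝ) 1, E) →L[ℝ] C(Icc (-1 : ℝ) 1, E) :=
  LinearMap.mkContinuous
    { toFun := fun γ => ⟨fun s => ∫ r in (0 : ℝ)..s, extendCurve γ r,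
        (intervalIntegral.continuous_primitive
          (fun a b => (continuous_extendCurve γ).intervalIntegrable a b) 0).comp
          continuous_subtype_val⟩
      map_add' := fun γ η => by
        ext s
        exact intervalIntegral.integral_add
          ((continuous_extendCurve γ).intervalIntegrable _ _)
          ((continuous_extendCurve η).intervalIntegrable _ _)
      map_smul' := fun c γ => by
        ext s
        exact intervalIntegral.integral_smul c (extendCurve γ) } 1
    (fun γ => by
      rw [ContinuousMap.norm_le _ (by positivity)]
      intro s
      refine (intervalIntegral.norm_integral_le_of_norm_le_const
        (fun r _ => norm_extendCurve_le γ r)).trans ?_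
      rw [one_mul, sub_zero]
      exact mul_le_of_le_one_right (norm_nonneg _) (abs_le.2 s.2))

/-- The constant curves. -/
noncomputable def constCurve (E : Type v) [NormedAddCommGroup E] [NormedSpace ℝ E] :
    E →L[ℝ] C(Icc (-1 : ℝ) 1, E) :=
  ContinuousLinearMap.const ℝ _

@[simp] lemma constCurve_apply (x : E) (s : Icc (-1 : ℝ) 1) : constCurve E x s = x := rfl

variable [CompleteSpace E]

/-- The integral operator `γ ↦ ∫₀ U(γ)` of the Picard iteration. -/
noncomputable def picardIntegral (U : E → E) (hU : Continuous U) (γ : C(Icc (-1 : ℝ) 1, E)) :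
    C(Icc (-1 : ℝ) 1, E) :=
  integrateCurve E ((⟨U, hU⟩ : C(E, E)).comp γ)

lemma smul_picardIntegral_apply (U : E → E) (hU : Continuous U) (γ : C(Icc (-1 : ℝ) 1, E))
    (c : ℝ) (s : Icc (-1 : ℝ) 1) :
    (c • picardIntegral U hU γ) s = c • ∫ r in (0 : ℝ)..s, U (extendCurve γ r) := rfl

/-- The solutions of `γ' = t U(γ)`, `γ 0 = x`, depend smoothly on `(t, x)`. -/
lemma exists_smooth_picard_solution {U : E → E} (hU : ContDiff ℝ ∞ U) (p : E) :
    ∃ δ₁ > 0, ∃ r > 0, ∃ Γ : ℝ → E → C(Icc (-1 : ℝ) 1, E),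
      ContDiffOn ℝ ∞ (fun q : ℝ × E => Γ q.1 q.2) {q | |q.1| < δ₁ ∧ dist q.2 p < δ₁} ∧
      (∀ {t : ℝ} {x : E}, |t| < δ₁ → dist x p < δ₁ →
        Γ t x = constCurve E x + t • picardIntegral U hU.continuous (Γ t x) ∧
          dist (Γ t x) (constCurve E p) < r) ∧
      ∀ {t : ℝ} {x : E} {γ : C(Icc (-1 : ℝ) 1, E)}, |t| < δ₁ → dist x p < δ₁ →
        γ = constCurve E x + t • picardIntegral U hU.continuous γ →
          dist γ (constCurve E p) < r → γ = Γ t x := by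
  set K := C(Icc (-1 : ℝ) 1, E) with hKdef
  set N : K → K := picardIntegral U hU.continuous with hN
  have hNs : ContDiff ℝ ∞ N :=
    (integrateCurve E).contDiff.comp (contDiff_postcomp hU hU.continuous)
  -- The curve `γ` solves the integral equation with parameters `(t, x)` exactly when `H (t, x, γ) =
  -- (t, x, 0)`. Keeping `t` and `x` as components turns an implicit function problem into the local
  -- inversion of `H`.
  set H : ℝ × E × K → ℝ × E × K :=
    fun q => (q.1, q.2.1, q.2.2 - constCurve E q.2.1 - q.1 • N q.2.2) with hH
  have hHs : ContDiff ℝ ∞ H := by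
    refine contDiff_fst.prodMk (contDiff_snd.fst.prodMk ?_)
    exact (contDiff_snd.snd.sub ((constCurve E).contDiff.comp contDiff_snd.fst)).sub
      (contDiff_fst.smul (hNs.comp contDiff_snd.snd))
  set a : ℝ × E × K := (0, p, constCurve E p) with ha
  set n₀ : K := N (constCurve E p) with hn₀
  -- At `t = 0` the derivative of `t • N γ` in the direction of `γ` vanishes, so the differential of
  -- `H` is triangular with identity diagonal and `L₂` inverts it explicitly.
  let L₁ : ℝ × E × K →L[ℝ] ℝ × E × K :=
    (ContinuousLinearMap.fst ℝ ℝ (E × K)).prod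
      (((ContinuousLinearMap.fst ℝ E K).comp (ContinuousLinearMap.snd ℝ ℝ (E × K))).prod
        ((ContinuousLinearMap.snd ℝ E K).comp (ContinuousLinearMap.snd ℝ ℝ (E × K)) -
          (constCurve E).comp
            ((ContinuousLinearMap.fst ℝ E K).comp (ContinuousLinearMap.snd ℝ ℝ (E × K))) -
          (ContinuousLinearMap.fst ℝ ℝ (E × K)).smulRight n₀))
  let L₂ : ℝ × E × K →L[ℝ] ℝ × E × K :=
    (ContinuousLinearMap.fst ℝ ℝ (E × K)).prod
      (((ContinuousLinearMap.fst ℝ E K).comp (ContinuousLinearMap.snd ℝ ℝ (E × K))).prod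
        ((ContinuousLinearMap.snd ℝ E K).comp (ContinuousLinearMap.snd ℝ ℝ (E × K)) +
          (constCurve E).comp
            ((ContinuousLinearMap.fst ℝ E K).comp (ContinuousLinearMap.snd ℝ ℝ (E × K))) +
          (ContinuousLinearMap.fst ℝ ℝ (E × K)).smulRight n₀))
  let L : (ℝ × E × K) ≃L[ℝ] ℝ × E × K := ContinuousLinearEquiv.equivOfInverse L₁ L₂
    (fun q => Prod.ext rfl (Prod.ext rfl (by
      change q.2.2 - constCurve E q.2.1 - q.1 • n₀ + constCurve E q.2.1 + q.1 • n₀ = q.2.2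
      abel)))
    (fun q => Prod.ext rfl (Prod.ext rfl (by
      change q.2.2 + constCurve E q.2.1 + q.1 • n₀ - constCurve E q.2.1 - q.1 • n₀ = q.2.2
      abel)))
  have hL : HasFDerivAt H (L : ℝ × E × K →L[ℝ] ℝ × E × K) a := by
    have h1 : HasFDerivAt (fun q : ℝ × E × K => q.1) (ContinuousLinearMap.fst ℝ ℝ (E × K)) a :=
      hasFDerivAt_fst
    have h2 : HasFDerivAt (fun q : ℝ × E × K => q.2.1)
        ((ContinuousLinearMap.fst ℝ E K).comp (ContinuousLinearMap.snd ℝ ℝ (E × K))) a :=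
      hasFDerivAt_snd.fst
    have h3 : HasFDerivAt (fun q : ℝ × E × K => q.2.2)
        ((ContinuousLinearMap.snd ℝ E K).comp (ContinuousLinearMap.snd ℝ ℝ (E × K))) a :=
      hasFDerivAt_snd.snd
    have hNd := (hNs.differentiable (by simp) (constCurve E p)).hasFDerivAt
    have h4 := h1.smul (hNd.comp a h3)
    have h5 := h1.prodMk (h2.prodMk ((h3.sub ((constCurve E).hasFDerivAt.comp a h2)).sub h4))
    convert! h5 using 1
    ext q <;> simp [L, L₁, a, hn₀]
  obtain ⟨e, hae, -, hecoe, hesymm⟩ :=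
    exists_openPartialHomeomorph_of_contDiffOn isOpen_univ hHs.contDiffOn (mem_univ a) L hL
  have hHa : H a = (0, p, 0) := by simp [hH, ha]
  obtain ⟨r, hr, hrs⟩ := Metric.isOpen_iff.1 e.open_source a hae
  have hWo : IsOpen (e.target ∩ e.symm ⁻¹' Metric.ball a r) :=
    e.symm.isOpen_inter_preimage Metric.isOpen_ball
  have hWm : ((0, p, 0) : ℝ × E × K) ∈ e.target ∩ e.symm ⁻¹' Metric.ball a r := by
    rw [← hHa, ← hecoe]
    refine ⟨e.map_source hae, ?_⟩
    rw [mem_preimage, e.left_inv hae]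
    exact Metric.mem_ball_self hr
  obtain ⟨δ₀, hδ₀, hδW⟩ := Metric.isOpen_iff.1 hWo _ hWm
  -- The bound by `δ₀` keeps `(t, x, 0)` in the target, which gives existence. The bound by `r`
  -- keeps `(t, x, γ)` in the source, where injectivity gives uniqueness.
  set δ₁ := min δ₀ r with hδ₁
  have hδ₁pos : 0 < δ₁ := lt_min hδ₀ hr
  set Γ : ℝ → E → K := fun t x => (e.symm (t, x, 0)).2.2 with hΓ
  have hmemW : ∀ {t : ℝ} {x : E}, |t| < δ₁ → dist x p < δ₁ →
      ((t, x, 0) : ℝ × E × K) ∈ e.target ∩ e.symm ⁻¹' Metric.ball a r := by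
    intro t x ht hx
    apply hδW
    rw [Metric.mem_ball, Prod.dist_eq, Prod.dist_eq]
    simp only [dist_self, Real.dist_eq, sub_zero]
    exact max_lt (ht.trans_le (min_le_left _ _)) (max_lt (hx.trans_le (min_le_left _ _)) hδ₀)
  refine ⟨δ₁, hδ₁pos, r, hr, Γ, ?_, ?_, ?_⟩
  · have h1 : ContDiffOn ℝ ∞ (fun q : ℝ × E => e.symm (q.1, q.2, (0 : K)))
        {q | |q.1| < δ₁ ∧ dist q.2 p < δ₁} :=
      hesymm.comp (contDiff_fst.prodMk (contDiff_snd.prodMk contDiff_const)).contDiffOn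
        fun q hq => (hmemW hq.1 hq.2).1
    exact contDiff_snd.comp_contDiffOn (contDiff_snd.comp_contDiffOn h1)
  · intro t x ht hx
    obtain ⟨hW1, hW2⟩ := hmemW ht hx
    have h := e.right_inv hW1
    rw [hecoe] at h
    have h1 : (e.symm (t, x, 0)).1 = t := congrArg Prod.fst h
    have h2 : (e.symm (t, x, 0)).2.1 = x := congrArg (fun q => q.2.1) h
    have h3 : (e.symm (t, x, 0)).2.2 - constCurve E (e.symm (t, x, 0)).2.1 -
      (e.symm (t, x, 0)).1 • N (e.symm (t, x, 0)).2.2 = 0 := congrArg (fun q => q.2.2) h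
    rw [h1, h2, sub_sub, sub_eq_zero] at h3
    refine ⟨h3, ?_⟩
    rw [mem_preimage, Metric.mem_ball, Prod.dist_eq, Prod.dist_eq] at hW2
    exact (max_lt_iff.1 (max_lt_iff.1 hW2).2).2
  · intro t x γ ht hx hγ hγr
    have hm : ((t, x, γ) : ℝ × E × K) ∈ e.source := by
      apply hrs
      rw [Metric.mem_ball, Prod.dist_eq, Prod.dist_eq]
      simp only [ha, Real.dist_eq, sub_zero]
      exact max_lt (ht.trans_le (min_le_right _ _))
        (max_lt (hx.trans_le (min_le_right _ _)) hγr)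
    have hv : e (t, x, γ) = (t, x, 0) := by
      rw [hecoe]
      refine Prod.ext rfl (Prod.ext rfl ?_)
      change γ - constCurve E x - t • N γ = 0
      rw [sub_sub, sub_eq_zero]
      exact hγ
    rw [hΓ]
    dsimp only
    rw [← hv, e.left_inv hm]

/-- Rescaling the time of the solutions of the integral equation. -/
lemma picard_rescale {U : E → E} (hU : Continuous U) {p : E} {δ₁ r : ℝ} (hr : 0 < r)
    {Γ : ℝ → E → C(Icc (-1 : ℝ) 1, E)}
    (hspec : ∀ {t : ℝ} {x : E}, |t| < δ₁ → dist x p < δ₁ →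
        Γ t x = constCurve E x + t • picardIntegral U hU (Γ t x) ∧
          dist (Γ t x) (constCurve E p) < r)
    (huniq : ∀ {t : ℝ} {x : E} {γ : C(Icc (-1 : ℝ) 1, E)}, |t| < δ₁ → dist x p < δ₁ →
        γ = constCurve E x + t • picardIntegral U hU γ →
          dist γ (constCurve E p) < r → γ = Γ t x)
    {t : ℝ} {x : E} (s : Icc (-1 : ℝ) 1) (ht : |t| < δ₁) (hx : dist x p < δ₁) :
    Γ (s * t) x ⟨1, by norm_num, le_rfl⟩ = Γ t x s := by
  obtain ⟨hfix, hdist⟩ := hspec ht hx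
  set γ := Γ t x with hγdef
  have hs : |(s : ℝ)| ≤ 1 := abs_le.2 s.2
  have hmem : ∀ q : ℝ, |q| ≤ 1 → (s : ℝ) * q ∈ Icc (-1 : ℝ) 1 := by
    intro q hq
    refine mem_Icc.2 (abs_le.1 ?_)
    rw [abs_mul]
    exact mul_le_one₀ hs (abs_nonneg _) hq
  -- The curve slowed down by the factor `s` solves the equation with parameter `s * t`, so
  -- uniqueness identifies it with `Γ (s * t) x`.
  let η : C(Icc (-1 : ℝ) 1, E) := ⟨fun q => extendCurve γ (s * q),
    (continuous_extendCurve γ).comp (continuous_const.mul continuous_subtype_val)⟩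
  have hηγ : ∀ q : Icc (-1 : ℝ) 1, η q = γ ⟨s * q, hmem q (abs_le.2 q.2)⟩ :=
    fun q => extendCurve_coe γ ⟨s * q, hmem q (abs_le.2 q.2)⟩
  have hη : η = Γ (s * t) x := by
    refine huniq ?_ hx ?_ ?_
    · rw [abs_mul]
      exact (mul_le_of_le_one_left (abs_nonneg _) hs).trans_lt ht
    · ext q
      have hq : |(q : ℝ)| ≤ 1 := abs_le.2 q.2
      rw [hηγ q, DFunLike.congr_fun hfix, ContinuousMap.add_apply, ContinuousMap.add_apply, constCurve_apply,
        constCurve_apply, smul_picardIntegral_apply, smul_picardIntegral_apply]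
      congr 1
      have h2 : ∫ r in (0 : ℝ)..q, U (extendCurve η r) =
          ∫ r in (0 : ℝ)..q, U (extendCurve γ (s * r)) := by
        refine intervalIntegral.integral_congr fun τ hτ => ?_
        have hτ' : τ ∈ Icc (-1 : ℝ) 1 := by
          have h0 : (0 : ℝ) ∈ Icc (-1 : ℝ) 1 := by norm_num
          exact (uIcc_subset_Icc h0 q.2) hτ
        have h3 : extendCurve η τ = extendCurve γ (s * τ) := extendCurve_coe η ⟨τ, hτ'⟩
        simp only [h3]
      rw [h2, mul_comm (s : ℝ) t, mul_smul,
        intervalIntegral.smul_integral_comp_mul_left (fun z => U (extendCurve γ z)), mul_zero]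
    · rw [ContinuousMap.dist_lt_iff hr]
      intro q
      have hq : |(q : ℝ)| ≤ 1 := abs_le.2 q.2
      rw [hηγ q]
      exact (ContinuousMap.dist_apply_le_dist (f := γ) (g := constCurve E p)
        ⟨s * q, hmem q hq⟩).trans_lt hdist
  rw [← hη]
  change extendCurve γ (s * 1) = γ s
  rw [mul_one, extendCurve_coe]

/-- The local flow of a smooth vector field depends smoothly on time and on the initial point. -/
lemma exists_smooth_flow {U : E → E} (hU : ContDiff ℝ ∞ U) (p : E) :
    ∃ δ > 0, ∃ F : ℝ × E → E, ContDiffOn ℝ ∞ F (Ioo (-δ) δ ×ˢ Metric.ball p δ) ∧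
      (∀ x ∈ Metric.ball p δ, F (0, x) = x) ∧
      ∀ t ∈ Ioo (-δ) δ, ∀ x ∈ Metric.ball p δ,
        HasDerivAt (fun t => F (t, x)) (U (F (t, x))) t := by
  obtain ⟨δ₁, hδ₁pos, r, hr, Γ, hΓ, hspec, huniq⟩ := exists_smooth_picard_solution hU p
  -- Since `Γ t x` solves `γ' = t U(γ)`, the flow at time `t` is its value at `1`. Halving makes `δ₁
  -- / 2` itself an admissible parameter: by rescaling, the whole trajectory of `x` is read off the
  -- single curve `Γ (δ₁ / 2) x`.
  refine ⟨δ₁ / 2, half_pos hδ₁pos, fun q => Γ q.1 q.2 ⟨1, by norm_num, le_rfl⟩, ?_, ?_, ?_⟩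
  · have h1 : ContDiffOn ℝ ∞ (fun q : ℝ × E => Γ q.1 q.2)
        (Ioo (-(δ₁ / 2)) (δ₁ / 2) ×ˢ Metric.ball p (δ₁ / 2)) := by
      refine hΓ.mono ?_
      rintro ⟨t, x⟩ ⟨ht, hx⟩
      exact ⟨(abs_lt.2 ht).trans (half_lt_self hδ₁pos),
        (Metric.mem_ball.1 hx).trans (half_lt_self hδ₁pos)⟩
    exact (ContinuousMap.evalCLM ℝ
      (⟨1, by norm_num, le_rfl⟩ : Icc (-1 : ℝ) 1)).contDiff.comp_contDiffOn h1
  · intro x hx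
    have h := (hspec (t := 0) (by simpa using hδ₁pos)
      ((Metric.mem_ball.1 hx).trans (half_lt_self hδ₁pos))).1
    rw [zero_smul, add_zero] at h
    simp only [h, constCurve_apply]
  · intro t ht x hx
    have hx' : dist x p < δ₁ := (Metric.mem_ball.1 hx).trans (half_lt_self hδ₁pos)
    set d := δ₁ / 2 with hd
    have hdpos : 0 < d := half_pos hδ₁pos
    have hdlt : |d| < δ₁ := by rw [abs_of_pos hdpos]; exact half_lt_self hδ₁pos
    set γ := Γ d x with hγdef
    have hFγ : ∀ τ ∈ Ioo (-d) d,
        Γ τ x ⟨1, by norm_num, le_rfl⟩ = x + d • ∫ r in (0 : ℝ)..(τ / d), U (extendCurve γ r) := by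
      intro τ hτ
      have hτ' : τ / d ∈ Icc (-1 : ℝ) 1 := by
        refine mem_Icc.2 (abs_le.1 ?_)
        rw [abs_div, abs_of_pos hdpos, div_le_one hdpos]
        exact (abs_lt.2 hτ).le
      have h := picard_rescale hU.continuous hr hspec huniq (t := d) (x := x) ⟨τ / d, hτ'⟩ hdlt hx'
      simp only [div_mul_cancel₀ _ hdpos.ne'] at h
      rw [h, (hspec hdlt hx').1, ContinuousMap.add_apply, smul_picardIntegral_apply, constCurve_apply]
    have hval : Γ t x ⟨1, by norm_num, le_rfl⟩ = extendCurve γ (t / d) := by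
      have hτ' : t / d ∈ Icc (-1 : ℝ) 1 := by
        refine mem_Icc.2 (abs_le.1 ?_)
        rw [abs_div, abs_of_pos hdpos, div_le_one hdpos]
        exact (abs_lt.2 ht).le
      have h := picard_rescale hU.continuous hr hspec huniq (t := d) (x := x) ⟨t / d, hτ'⟩ hdlt hx'
      simp only [div_mul_cancel₀ _ hdpos.ne'] at h
      rw [h]
      exact (extendCurve_coe γ ⟨t / d, hτ'⟩).symm
    have hcont : Continuous fun r => U (extendCurve γ r) :=
      hU.continuous.comp (continuous_extendCurve γ)
    have hprim := intervalIntegral.integral_hasDerivAt_right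
      (hcont.intervalIntegrable 0 (t / d)) (hcont.stronglyMeasurableAtFilter _ _) hcont.continuousAt
    have hcomp := ((hprim.scomp t ((hasDerivAt_id t).div_const d)).const_smul d).const_add x
    rw [smul_smul, mul_one_div_cancel hdpos.ne', one_smul, ← hval] at hcomp
    refine hcomp.congr_of_eventuallyEq ?_
    filter_upwards [isOpen_Ioo.mem_nhds ht] with τ hτ
    exact hFγ τ hτ

end Flow

/-! ### Flow boxes adapted to a vector field and a closed 1-form. -/

section FlowBox

variable {m : ℕ}

/-- A vector field which is smooth on a neighbourhood of a point agrees near the point with a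
globally smooth one. -/
lemma exists_contDiff_eqOn_ball {E F : Type*} [NormedAddCommGroup E] [InnerProductSpace ℝ E]
    [FiniteDimensional ℝ E] [NormedAddCommGroup F] [NormedSpace ℝ F] {s : Set E} (hs : IsOpen s)
    {p : E} (hp : p ∈ s) {U : E → F} (hU : ContDiffOn ℝ ∞ U s) :
    ∃ ρ > 0, Metric.ball p ρ ⊆ s ∧ ∃ U' : E → F, ContDiff ℝ ∞ U' ∧ EqOn U' U (Metric.ball p ρ) := by
  obtain ⟨ε, hε, hεs⟩ := Metric.isOpen_iff.1 hs p hp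
  let b : ContDiffBump p := ⟨ε / 3, ε / 2, by positivity, by linarith⟩
  refine ⟨ε / 3, by positivity, (Metric.ball_subset_ball (by linarith)).trans hεs,
    fun y => b y • U y, ?_, ?_⟩
  · rw [contDiff_iff_contDiffAt]
    intro y
    by_cases hy : y ∈ s
    · exact b.contDiff.contDiffAt.smul (hU.contDiffAt (hs.mem_nhds hy))
    · have hyt : y ∉ tsupport b := by
        rw [b.tsupport_eq]
        intro h
        exact hy (hεs (Metric.closedBall_subset_ball (by change ε / 2 < ε; linarith) h))
      have h0 : b =ᶠ[𝓝 y] 0 := notMem_tsupport_iff_eventuallyEq.1 hyt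
      refine (contDiffAt_const (c := (0 : F))).congr_of_eventuallyEq ?_
      filter_upwards [h0] with z hz
      rw [hz, Pi.zero_apply, zero_smul]
  · intro y hy
    have : b y = 1 := b.one_of_mem_closedBall (Metric.ball_subset_closedBall hy)
    simp only [this, one_smul]

/-- The product of the interval `(-δ, δ)` and the `δ`-ball. -/
def box (m : ℕ) (δ : ℝ) : Set (Model m) :=
  {y | y 0 ∈ Ioo (-δ) δ ∧ spacePart y ∈ Metric.ball 0 δ}

/-- The embedding `x ↦ (t, x)` of a time slice. -/
def slice (t : ℝ) (x : EuclideanSpace ℝ (Fin m)) : Model m :=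
  WithLp.toLp 2 (Fin.cons t (WithLp.ofLp x))

@[simp] lemma slice_zero (t : ℝ) (x : EuclideanSpace ℝ (Fin m)) : slice t x 0 = t := rfl

@[simp] lemma slice_succ (t : ℝ) (x : EuclideanSpace ℝ (Fin m)) (a : Fin m) :
    slice t x a.succ = x a := rfl

@[simp] lemma spacePart_apply (y : Model m) (a : Fin m) : spacePart y a = y a.succ := rfl

@[simp] lemma spacePart_slice (t : ℝ) (x : EuclideanSpace ℝ (Fin m)) :
    spacePart (slice t x) = x := by
  ext a; rfl

@[simp] lemma slice_spacePart (y : Model m) : slice (y 0) (spacePart y) = y := by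
  ext i
  refine Fin.cases ?_ (fun a => ?_) i <;> rfl

lemma contDiff_spacePart : ContDiff ℝ ∞ (spacePart : Model m → EuclideanSpace ℝ (Fin m)) := by
  rw [contDiff_euclidean]
  intro a
  exact (EuclideanSpace.proj (𝕜 := ℝ) a.succ).contDiff

lemma contDiff_coord (i : Fin (m + 1)) : ContDiff ℝ ∞ (fun y : Model m => y i) :=
  (EuclideanSpace.proj (𝕜 := ℝ) i).contDiff

lemma contDiff_slice :
    ContDiff ℝ ∞ (fun q : ℝ × EuclideanSpace ℝ (Fin m) => slice q.1 q.2) := by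
  rw [contDiff_euclidean]
  intro i
  refine Fin.cases ?_ (fun a => ?_) i
  · exact contDiff_fst
  · exact ((EuclideanSpace.proj (𝕜 := ℝ) a).contDiff).comp contDiff_snd

lemma isOpen_box (δ : ℝ) : IsOpen (box m δ) :=
  (isOpen_Ioo.preimage (contDiff_coord 0).continuous).inter
    (Metric.isOpen_ball.preimage contDiff_spacePart.continuous)

lemma zero_mem_box {δ : ℝ} (hδ : 0 < δ) : (0 : Model m) ∈ box m δ := by
  have : spacePart (0 : Model m) = 0 := by ext; rfl
  exact ⟨⟨by simpa using hδ, by simpa using hδ⟩, by rw [this]; exact Metric.mem_ball_self hδ⟩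

lemma exists_box_subset {s : Set (Model m)} (hs : IsOpen s) (h0 : (0 : Model m) ∈ s) :
    ∃ δ > 0, box m δ ⊆ s := by
  have hc : Continuous (fun q : ℝ × EuclideanSpace ℝ (Fin m) => slice q.1 q.2) :=
    contDiff_slice.continuous
  have h0' : slice (m := m) 0 0 = 0 := by
    ext i
    refine Fin.cases ?_ (fun a => ?_) i <;> rfl
  obtain ⟨δ, hδ, hδs⟩ := Metric.isOpen_iff.1 (hs.preimage hc) (0, 0) (by simpa [h0'] using h0)
  refine ⟨δ, hδ, fun y hy => ?_⟩
  have : (y 0, spacePart y) ∈ Metric.ball ((0 : ℝ), (0 : EuclideanSpace ℝ (Fin m))) δ := by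
    rw [Metric.mem_ball, Prod.dist_eq]
    refine max_lt ?_ hy.2
    rw [Real.dist_eq, sub_zero]
    exact abs_lt.2 hy.1
  simpa using hδs this

set_option maxHeartbeats 800000 in
/-- Coordinates `(t, x)` adapted to a vector field `U` and a closed 1-form `θ` with `θ(U) = 1`:
`U` becomes `∂ₜ` and `θ` becomes `dt`. -/
lemma exists_flowBox {s : Set (Model m)} (hs : IsOpen s) {p : Model m} (hp : p ∈ s)
    {U : Model m → Model m} (hU : ContDiffOn ℝ ∞ U s) {θ : Model m → Model m →L[ℝ] ℝ}
    (hθ : ContDiffOn ℝ ∞ θ s)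
    (hclosed : ∀ y ∈ s, ∀ v w, fderiv ℝ θ y v w = fderiv ℝ θ y w v)
    (hθU : ∀ y ∈ s, θ y (U y) = 1) :
    ∃ δ > 0, ∃ e : OpenPartialHomeomorph (Model m) (Model m), e.source = box m δ ∧
      e.target ⊆ s ∧ p ∈ e.target ∧ ContDiffOn ℝ ∞ e e.source ∧ ContDiffOn ℝ ∞ e.symm e.target ∧
      ∀ y ∈ e.source, fderiv ℝ e y (stdVec 0) = U (e y) ∧ ∀ v, θ (e y) (fderiv ℝ e y v) = v 0 := by
  -- The flow lemma needs a globally smooth field. The ball is also convex, so the closed form `θ`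
  -- has a potential `t` on it.
  obtain ⟨ρ, hρ, hρs, U', hU', hUU'⟩ := exists_contDiff_eqOn_ball hs hp hU
  set b := Metric.ball p ρ with hb
  have hbo : IsOpen b := Metric.isOpen_ball
  have hpb : p ∈ b := Metric.mem_ball_self hρ
  -- a potential of the 1-form
  obtain ⟨t₀, ht₀⟩ := (convex_ball p ρ).exists_forall_hasFDerivAt_of_fderiv_symmetric hbo
    ((hθ.mono hρs).differentiableOn (by simp)) (fun y hy => hclosed y (hρs hy))
  obtain ⟨t, ht, htp⟩ : ∃ t : Model m → ℝ, (∀ y ∈ b, HasFDerivAt t (θ y) y) ∧ t p = 0 :=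
    ⟨fun y => t₀ y - t₀ p, fun y hy => (ht₀ y hy).sub_const _, sub_self _⟩
  have hts : ContDiffOn ℝ ∞ t b := by
    rw [contDiffOn_infty_iff_fderiv_of_isOpen hbo]
    exact ⟨fun y hy => (ht y hy).differentiableAt.differentiableWithinAt,
      (hθ.mono hρs).congr fun y hy => (ht y hy).fderiv⟩
  -- the flow
  obtain ⟨δF, hδF, F, hFs, hF0, hFd⟩ := exists_smooth_flow hU' p
  have hFp : F (0, p) = p := hF0 p (Metric.mem_ball_self hδF)
  have hmem0 : ((0 : ℝ), p) ∈ Ioo (-δF) δF ×ˢ Metric.ball p δF :=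
    ⟨⟨by simpa using hδF, hδF⟩, Metric.mem_ball_self hδF⟩
  have hopenF : IsOpen (Ioo (-δF) δF ×ˢ Metric.ball p δF) := isOpen_Ioo.prod Metric.isOpen_ball
  have hFc0 : ContinuousAt F (0, p) := (hFs.contDiffAt (hopenF.mem_nhds hmem0)).continuousAt
  obtain ⟨δ₂, hδ₂, hδ₂F, hδ₂b⟩ : ∃ δ₂ > 0, δ₂ ≤ δF ∧
      ∀ τ ∈ Ioo (-δ₂) δ₂, ∀ x ∈ Metric.ball p δ₂, F (τ, x) ∈ b := by
    have : F ⁻¹' b ∈ 𝓝 ((0 : ℝ), p) := hFc0.preimage_mem_nhds (by rw [hFp]; exact hbo.mem_nhds hpb)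
    obtain ⟨r, hr, hrb⟩ := Metric.mem_nhds_iff.1 this
    refine ⟨min r δF, lt_min hr hδF, min_le_right _ _, fun τ hτ x hx => hrb ?_⟩
    rw [Metric.mem_ball, Prod.dist_eq, Real.dist_eq, sub_zero]
    exact max_lt ((abs_lt.2 hτ).trans_le (min_le_left _ _))
      ((Metric.mem_ball.1 hx).trans_le (min_le_left _ _))
  have hIoo : ∀ {τ : ℝ}, τ ∈ Ioo (-δ₂) δ₂ → τ ∈ Ioo (-δF) δF := fun h =>
    ⟨by linarith [h.1], by linarith [h.2]⟩
  have hball : ∀ {x}, x ∈ Metric.ball p δ₂ → x ∈ Metric.ball p δF := fun h =>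
    Metric.ball_subset_ball hδ₂F h
  have hFderiv : ∀ τ ∈ Ioo (-δ₂) δ₂, ∀ x ∈ Metric.ball p δ₂,
      HasDerivAt (fun τ => F (τ, x)) (U (F (τ, x))) τ := by
    intro τ hτ x hx
    rw [← hUU' (hδ₂b τ hτ x hx)]
    exact hFd τ (hIoo hτ) x (hball hx)
  -- As `θ(U) = 1`, the potential increases at unit speed along the flow.
  have htF : ∀ τ ∈ Ioo (-δ₂) δ₂, ∀ x ∈ Metric.ball p δ₂, t (F (τ, x)) = t x + τ := by
    intro τ hτ x hx
    have h0 : (0 : ℝ) ∈ Ioo (-δ₂) δ₂ := ⟨by simpa using hδ₂, hδ₂⟩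
    have hd : ∀ σ ∈ Ioo (-δ₂) δ₂, HasDerivAt (fun σ => t (F (σ, x)) - σ) 0 σ := by
      intro σ hσ
      have h1 := (ht _ (hδ₂b σ hσ x hx)).comp_hasDerivAt σ (hFderiv σ hσ x hx)
      rw [hθU _ (hρs (hδ₂b σ hσ x hx))] at h1
      have h2 := h1.sub (hasDerivAt_id σ)
      rw [sub_self] at h2
      exact h2
    have := (convex_Ioo (-δ₂) δ₂).is_const_of_fderivWithin_eq_zero (𝕜 := ℝ)
      (fun σ hσ => (hd σ hσ).differentiableAt.differentiableWithinAt)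
      (fun σ hσ => by
        rw [fderivWithin_of_isOpen isOpen_Ioo hσ]
        ext
        simp [(hd σ hσ).deriv]) hτ h0
    simp only [sub_zero, hF0 x (hball hx)] at this
    linarith
  -- the linear part
  have hUp : U p ≠ 0 := by
    intro h
    have := hθU p hp
    rw [h, map_zero] at this
    exact zero_ne_one this
  have he0 : (stdVec 0 : Model m) ≠ 0 := by
    intro h
    have := congrArg (fun v : Model m => v 0) h
    simp [stdVec] at this
  obtain ⟨T, hT⟩ := SeparatingDual.exists_continuousLinearEquiv_apply_eq (R := ℝ) he0 hUp
  let π : Model m →L[ℝ] ℝ := EuclideanSpace.proj (0 : Fin (m + 1))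
  have hπ : ∀ v : Model m, π v = v 0 := fun v => rfl
  have hπ0 : π (stdVec 0) = 1 := by simp [hπ, stdVec]
  -- `L` kills `∂₀` and carries the hyperplane `v 0 = 0` onto a complement of `U p`, so `p + L y`
  -- runs through a transversal to the flow.
  let L : Model m →L[ℝ] Model m :=
    (T : Model m →L[ℝ] Model m).comp (ContinuousLinearMap.id ℝ _ - π.smulRight (stdVec 0))
  have hL : ∀ v, L v = T v - π v • U p := by
    intro v
    simp [L, hT]
  have hL0 : L (stdVec 0) = 0 := by rw [hL, hT, hπ0, one_smul, sub_self]
  -- the parametrization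
  set A : Model m → ℝ × Model m := fun y => (π y - t (p + L y), p + L y) with hA
  have hA0 : A 0 = (0, p) := by simp [hA, htp]
  have hLs : ContDiff ℝ ∞ fun y => p + L y := contDiff_const.add L.contDiff
  set D₀ : Set (Model m) := (fun y => p + L y) ⁻¹' b with hD₀
  have hD₀o : IsOpen D₀ := hbo.preimage hLs.continuous
  have hAs : ContDiffOn ℝ ∞ A D₀ :=
    (π.contDiff.contDiffOn.sub (hts.comp hLs.contDiffOn fun y hy => hy)).prodMk hLs.contDiffOn
  set D₁ : Set (Model m) := D₀ ∩ A ⁻¹' (Ioo (-δ₂) δ₂ ×ˢ Metric.ball p δ₂) with hD₁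
  have hD₁o : IsOpen D₁ := hAs.continuousOn.isOpen_inter_preimage hD₀o
    (isOpen_Ioo.prod Metric.isOpen_ball)
  have h0D₁ : (0 : Model m) ∈ D₁ := by
    refine ⟨by simpa [hD₀] using hpb, ?_⟩
    rw [mem_preimage, hA0]
    exact ⟨⟨by simpa using hδ₂, hδ₂⟩, Metric.mem_ball_self hδ₂⟩
  set Φ : Model m → Model m := fun y => F (A y) with hΦ
  have hΦs : ContDiffOn ℝ ∞ Φ D₁ :=
    hFs.comp (hAs.mono inter_subset_left) fun y hy => ⟨hIoo hy.2.1, hball hy.2.2⟩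
  have hΦd : ∀ y ∈ D₁, HasFDerivAt Φ (fderiv ℝ Φ y) y := fun y hy =>
    ((hΦs.contDiffAt (hD₁o.mem_nhds hy)).differentiableAt (by simp)).hasFDerivAt
  have hΦb : ∀ y ∈ D₁, Φ y ∈ b := fun y hy => hδ₂b _ hy.2.1 _ hy.2.2
  have hΦ0 : ∀ y ∈ D₁, fderiv ℝ Φ y (stdVec 0) = U (Φ y) := by
    intro y hy
    have h1 : HasDerivAt (fun τ : ℝ => y + τ • (stdVec 0 : Model m)) (stdVec 0) 0 := by
      simpa using ((hasDerivAt_id (0 : ℝ)).smul_const (stdVec 0 : Model m)).const_add y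
    have h2 : HasDerivAt (fun τ : ℝ => Φ (y + τ • (stdVec 0 : Model m)))
        (fderiv ℝ Φ y (stdVec 0)) 0 := by
      have h : HasFDerivAt Φ (fderiv ℝ Φ y) (y + (0 : ℝ) • (stdVec 0 : Model m)) := by
        rw [zero_smul, add_zero]
        exact hΦd y hy
      exact h.comp_hasDerivAt (0 : ℝ) h1
    have h3 : (fun τ : ℝ => Φ (y + τ • (stdVec 0 : Model m))) =
        fun τ => F ((A y).1 + τ, (A y).2) := by
      funext τ
      simp only [hΦ, hA, map_add, map_smul, hL0, hπ0, smul_zero, add_zero, smul_eq_mul, mul_one]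
      congr 2
      ring
    have h4 : HasDerivAt (fun τ : ℝ => F ((A y).1 + τ, (A y).2)) (U (Φ y)) 0 := by
      have h5 := hFderiv _ hy.2.1 _ hy.2.2
      have h6 : HasDerivAt (fun τ : ℝ => (A y).1 + τ) 1 0 := by
        simpa using (hasDerivAt_id (0 : ℝ)).const_add (A y).1
      have h7 : HasDerivAt (fun τ => F (τ, (A y).2)) (U (Φ y)) ((A y).1 + 0) := by
        rw [add_zero]
        exact h5
      have h8 := HasDerivAt.scomp (0 : ℝ) h7 h6
      rw [one_smul] at h8
      exact h8
    rw [h3] at h2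
    exact h2.unique h4
  have htΦ : ∀ y ∈ D₁, t (Φ y) = π y := by
    intro y hy
    rw [hΦ]
    change t (F ((A y).1, (A y).2)) = π y
    rw [htF _ hy.2.1 _ hy.2.2]
    simp [hA]
  have hθΦ : ∀ y ∈ D₁, ∀ v, θ (Φ y) (fderiv ℝ Φ y v) = v 0 := by
    intro y hy v
    have h1 : HasFDerivAt (fun y => t (Φ y)) ((θ (Φ y)).comp (fderiv ℝ Φ y)) y :=
      (ht _ (hΦb y hy)).comp y (hΦd y hy)
    have h2 : HasFDerivAt (fun y => t (Φ y)) π y := by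
      refine π.hasFDerivAt.congr_of_eventuallyEq ?_
      filter_upwards [hD₁o.mem_nhds hy] with z hz
      exact htΦ z hz
    exact DFunLike.congr_fun (h1.unique h2) v
  have hΦp : Φ 0 = p := by simp only [hΦ, hA0, hFp]
  -- invertibility of the derivative at the origin
  obtain ⟨Φ', hΦ'⟩ : ∃ Φ' : Model m ≃L[ℝ] Model m, HasFDerivAt Φ (Φ' : Model m →L[ℝ] Model m) 0 := by
    -- In finite dimension injectivity suffices. Pairing a kernel vector `v` with `θ` gives `v 0 =
    -- 0`. Then `T v` is a multiple of `U p = T (stdVec 0)`, so `v` is a multiple of `stdVec 0` with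
    -- vanishing zeroth coordinate.
    have hinj : Function.Injective (fderiv ℝ Φ 0) := by
      rw [injective_iff_map_eq_zero]
      intro v hv
      have hv0 : v 0 = 0 := by
        rw [← hθΦ 0 h0D₁ v, hv, map_zero]
      have hFd0 : HasFDerivAt F (fderiv ℝ F (0, p)) (0, p) :=
        ((hFs.contDiffAt (hopenF.mem_nhds hmem0)).differentiableAt (by simp)).hasFDerivAt
      have hAd : HasFDerivAt A ((π - (θ p).comp L).prod L) 0 := by
        have h1 : HasFDerivAt (fun y => p + L y) L (0 : Model m) := L.hasFDerivAt.const_add p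
        have h2 : HasFDerivAt (fun y => t (p + L y)) ((θ p).comp L) (0 : Model m) :=
          HasFDerivAt.comp (0 : Model m) (by simpa using ht p hpb) h1
        exact (π.hasFDerivAt.sub h2).prodMk h1
      have h3 : fderiv ℝ Φ 0 = (fderiv ℝ F (0, p)).comp ((π - (θ p).comp L).prod L) := by
        refine HasFDerivAt.fderiv ?_
        exact HasFDerivAt.comp (0 : Model m) (by rw [hA0]; exact hFd0) hAd
      have hF1 : fderiv ℝ F (0, p) (1, 0) = U p := by
        have h4 : HasDerivAt (fun τ : ℝ => (τ, p)) ((1 : ℝ), (0 : Model m)) 0 :=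
          (hasDerivAt_id (0 : ℝ)).prodMk (hasDerivAt_const _ _)
        have h5 := hFd0.comp_hasDerivAt (0 : ℝ) h4
        have h6 := hFderiv 0 ⟨by simpa using hδ₂, hδ₂⟩ p (Metric.mem_ball_self hδ₂)
        rw [hFp] at h6
        exact h5.unique h6
      have hF2 : ∀ w : Model m, fderiv ℝ F (0, p) (0, w) = w := by
        intro w
        have h4 : HasFDerivAt (fun x : Model m => ((0 : ℝ), x))
            (ContinuousLinearMap.inr ℝ ℝ (Model m)) p := hasFDerivAt_prodMk_right (0 : ℝ) p
        have h5 := hFd0.comp p h4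
        have h6 : HasFDerivAt (fun x : Model m => F (0, x)) (ContinuousLinearMap.id ℝ (Model m)) p := by
          refine (hasFDerivAt_id p).congr_of_eventuallyEq ?_
          filter_upwards [Metric.ball_mem_nhds p hδF] with x hx
          exact hF0 x hx
        exact DFunLike.congr_fun (h5.unique h6) w
      have hFtot : ∀ (c : ℝ) (w : Model m), fderiv ℝ F (0, p) (c, w) = c • U p + w := by
        intro c w
        have : (c, w) = c • ((1 : ℝ), (0 : Model m)) + ((0 : ℝ), w) := by ext <;> simp
        rw [this, map_add, map_smul, hF1, hF2]
      have hv' : (π v - θ p (L v)) • U p + L v = 0 := by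
        rw [← hFtot]
        have := hv
        rw [h3] at this
        exact this
      have hπv : π v = 0 := hv0
      rw [hL, hπv, zero_smul, sub_zero, zero_sub] at hv'
      have h7 : T v = T (θ p (T v) • stdVec 0) := by
        rw [map_smul, hT]
        rw [neg_smul, neg_add_eq_zero] at hv'
        exact hv'.symm
      have h8 := T.injective h7
      have h9 : π v = θ p (T v) := by
        conv_lhs => rw [h8]
        rw [map_smul, hπ0, smul_eq_mul, mul_one]
      rw [h8, ← h9, hπv, zero_smul]
    refine ⟨(LinearEquiv.ofInjectiveEndo (fderiv ℝ Φ 0 : Model m →ₗ[ℝ] Model m)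
      hinj).toContinuousLinearEquiv, ?_⟩
    convert! hΦd 0 h0D₁
  obtain ⟨e₀, he₀0, he₀D, he₀c, he₀s⟩ :=
    exists_openPartialHomeomorph_of_contDiffOn hD₁o hΦs h0D₁ Φ' hΦ'
  obtain ⟨δ, hδ, hδe⟩ := exists_box_subset e₀.open_source he₀0
  have hsrc : (e₀.restrOpen (box m δ) (isOpen_box δ)).source = box m δ :=
    inter_eq_right.2 hδe
  have hcoe : (e₀.restrOpen (box m δ) (isOpen_box δ) : Model m → Model m) = Φ := he₀c
  have hbD : box m δ ⊆ D₁ := hδe.trans he₀D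
  refine ⟨δ, hδ, e₀.restrOpen (box m δ) (isOpen_box δ), hsrc, ?_, ?_, ?_, ?_, ?_⟩
  · intro z hz
    have h1 := (e₀.restrOpen (box m δ) (isOpen_box δ)).map_target hz
    rw [hsrc] at h1
    rw [← (e₀.restrOpen (box m δ) (isOpen_box δ)).right_inv hz, hcoe]
    exact hρs (hΦb _ (hbD h1))
  · rw [← hΦp, ← hcoe]
    refine (e₀.restrOpen (box m δ) (isOpen_box δ)).map_source ?_
    rw [hsrc]
    exact zero_mem_box hδ
  · rw [hsrc, hcoe]
    exact hΦs.mono hbD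
  · exact he₀s.mono fun z hz => hz.1
  · rw [hsrc, hcoe]
    exact fun y hy => ⟨hΦ0 y (hbD hy), hθΦ y (hbD hy)⟩

end FlowBox

/-! ### Smoothness of components in charts, and coordinates adapted to the time-like field. -/

section AdaptedChart

variable {m : ℕ} {M : Type*} [TopologicalSpace M] [ChartedSpace (Model m) M]

lemma contMDiffOn_symm_of_mem_charts {e : OpenPartialHomeomorph M (Model m)} (he : e ∈ charts m M) :
    ContMDiffOn 𝓘(ℝ, Model m) 𝓘(ℝ, Model m) ∞ e.symm e.target :=
  contMDiffOn_symm_of_mem_maximalAtlas he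

lemma mdifferentiable_of_mem_charts {e : OpenPartialHomeomorph M (Model m)}
    (he : e ∈ charts m M) : e.MDifferentiable 𝓘(ℝ, Model m) 𝓘(ℝ, Model m) :=
  ⟨(contMDiffOn_of_mem_maximalAtlas he).mdifferentiableOn (by simp),
    (contMDiffOn_symm_of_mem_maximalAtlas he).mdifferentiableOn (by simp)⟩

lemma mfderiv_symm_injective {e : OpenPartialHomeomorph M (Model m)} (he : e ∈ charts m M)
    {y : Model m} (hy : y ∈ e.target) :
    Function.Injective (mfderiv 𝓘(ℝ, Model m) 𝓘(ℝ, Model m) e.symm y) :=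
  (mdifferentiable_of_mem_charts he).symm.mfderiv_injective hy

lemma sum_smul_stdVec (v : Model m) : ∑ i, v i • (stdVec i : Model m) = v := by
  ext j
  simp [stdVec, Pi.single_apply]

lemma mfderiv_symm_eq_sum (e : OpenPartialHomeomorph M (Model m)) (y v : Model m) :
    mfderiv 𝓘(ℝ, Model m) 𝓘(ℝ, Model m) e.symm y v = ∑ i, v i • coordVec e y i := by
  conv_lhs => rw [← sum_smul_stdVec v]
  exact (map_sum (mfderiv 𝓘(ℝ, Model m) 𝓘(ℝ, Model m) e.symm y) _ _).trans
    (Finset.sum_congr rfl fun i _ => map_smul _ _ _)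

variable [IsManifold 𝓘(ℝ, Model m) ∞ M]

/-- The coordinate vector fields are smooth. -/
lemma contMDiffOn_coordVec {e : OpenPartialHomeomorph M (Model m)} (he : e ∈ charts m M)
    (i : Fin (m + 1)) :
    ContMDiffOn 𝓘(ℝ, Model m) 𝓘(ℝ, Model m).tangent ∞
      (fun y : Model m => (⟨e.symm y, coordVec e y i⟩ : TangentBundle 𝓘(ℝ, Model m) M))
      e.target := by
  have : IsManifold 𝓘(ℝ, Model m) 1 M := IsManifold.of_le (n := ∞) (by simp)
  have h1 := (contMDiffOn_symm_of_mem_charts he).contMDiffOn_tangentMapWithin (m := ∞) (by simp)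
    e.open_target.uniqueMDiffOn
  have h2 : ContMDiffOn 𝓘(ℝ, Model m) 𝓘(ℝ, Model m).tangent ∞
      (fun y : Model m => (⟨y, stdVec i⟩ : TangentBundle 𝓘(ℝ, Model m) (Model m))) e.target :=
    contMDiffOn_vectorSpace_iff_contDiffOn.2 contDiffOn_const
  refine (h1.comp h2 fun y hy => hy).congr fun y hy => ?_
  simp only [Function.comp, tangentMapWithin, coordVec,
    mfderivWithin_of_isOpen e.open_target hy]

lemma contDiffOn_metric (g : LorentzMetric m M) {e : OpenPartialHomeomorph M (Model m)}
    (he : e ∈ charts m M) {v w : ∀ y : Model m, TangentSpace 𝓘(ℝ, Model m) (e.symm y)}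
    (hv : ContMDiffOn 𝓘(ℝ, Model m) 𝓘(ℝ, Model m).tangent ∞
      (fun y : Model m => (⟨e.symm y, v y⟩ : TangentBundle 𝓘(ℝ, Model m) M)) e.target)
    (hw : ContMDiffOn 𝓘(ℝ, Model m) 𝓘(ℝ, Model m).tangent ∞
      (fun y : Model m => (⟨e.symm y, w y⟩ : TangentBundle 𝓘(ℝ, Model m) M)) e.target) :
    ContDiffOn ℝ ∞ (fun y => g.val (e.symm y) (v y) (w y)) e.target := by
  rw [← contMDiffOn_iff_contDiffOn]
  intro y hy
  have : ContMDiffWithinAt 𝓘(ℝ, Model m) (𝓘(ℝ, Model m).prod 𝓘(ℝ)) ∞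
      (fun y ↦ Bundle.TotalSpace.mk' ℝ (E := Bundle.Trivial M ℝ) (e.symm y)
        (g.val (e.symm y) (v y) (w y))) e.target y := by
    apply ContMDiffWithinAt.clm_bundle_apply₂ (F₁ := Model m) (F₂ := Model m)
    · exact ContMDiffAt.comp_contMDiffWithinAt y g.smooth.contMDiffAt
        (contMDiffOn_symm_of_mem_charts he y hy)
    · exact hv y hy
    · exact hw y hy
  simp only [Bundle.contMDiffWithinAt_totalSpace] at this
  exact this.2

lemma contMDiffOn_field {X : Field m M} (hX : IsSmoothField X)
    {e : OpenPartialHomeomorph M (Model m)} (he : e ∈ charts m M) :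
    ContMDiffOn 𝓘(ℝ, Model m) 𝓘(ℝ, Model m).tangent ∞
      (fun y : Model m => (⟨e.symm y, X (e.symm y)⟩ : TangentBundle 𝓘(ℝ, Model m) M))
      e.target :=
  hX.comp_contMDiffOn (contMDiffOn_symm_of_mem_charts he)

lemma contDiffOn_comp (g : LorentzMetric m M) {e : OpenPartialHomeomorph M (Model m)}
    (he : e ∈ charts m M) (i j : Fin (m + 1)) :
    ContDiffOn ℝ ∞ (fun y => g.comp e y i j) e.target :=
  contDiffOn_metric g he (contMDiffOn_coordVec he i) (contMDiffOn_coordVec he j)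

lemma contDiffOn_lower (g : LorentzMetric m M) {X : Field m M} (hX : IsSmoothField X)
    {e : OpenPartialHomeomorph M (Model m)} (he : e ∈ charts m M) (i : Fin (m + 1)) :
    ContDiffOn ℝ ∞ (g.lower X e i) e.target :=
  contDiffOn_metric g he (contMDiffOn_field hX he) (contMDiffOn_coordVec he i)

/-- The components of a smooth vector field in a chart, as a vector of the model space. -/
noncomputable def chartField (X : Field m M) (e : OpenPartialHomeomorph M (Model m)) (y : Model m) : Model m :=
  mfderiv 𝓘(ℝ, Model m) 𝓘(ℝ, Model m) e (e.symm y) (X (e.symm y))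

lemma contDiffOn_chartField {X : Field m M} (hX : IsSmoothField X)
    {e : OpenPartialHomeomorph M (Model m)} (he : e ∈ charts m M) :
    ContDiffOn ℝ ∞ (chartField X e) e.target := by
  have : IsManifold 𝓘(ℝ, Model m) 1 M := IsManifold.of_le (n := ∞) (by simp)
  have h1 := (contMDiffOn_of_mem_maximalAtlas he).contMDiffOn_tangentMapWithin (m := ∞) (by simp)
    e.open_source.uniqueMDiffOn
  refine (contMDiffOn_vectorSpace_iff_contDiffOn
    (V := fun y : Model m => (chartField X e y : TangentSpace 𝓘(ℝ, Model m) y))).1 ?_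
  refine (h1.comp (contMDiffOn_field hX he) fun y hy => e.map_target hy).congr fun y hy => ?_
  simp only [Function.comp, tangentMapWithin, chartField,
    mfderivWithin_of_isOpen e.open_source (e.map_target hy)]
  exact Bundle.TotalSpace.ext (e.right_inv hy).symm HEq.rfl

lemma mfderiv_symm_chartField {X : Field m M} {e : OpenPartialHomeomorph M (Model m)}
    (he : e ∈ charts m M) {y : Model m} (hy : y ∈ e.target) :
    mfderiv 𝓘(ℝ, Model m) 𝓘(ℝ, Model m) e.symm y (chartField X e y) = X (e.symm y) := by
  have : IsManifold 𝓘(ℝ, Model m) 1 M := IsManifold.of_le (n := ∞) (by simp)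
  have h := (mdifferentiable_of_mem_charts he).symm_comp_deriv (e.map_target hy)
  have h' := DFunLike.congr_fun h (X (e.symm y))
  rw [e.right_inv hy] at h'
  exact h'

lemma comp_symm (g : LorentzMetric m M) (e : OpenPartialHomeomorph M (Model m)) (y : Model m)
    (i j : Fin (m + 1)) : g.comp e y i j = g.comp e y j i :=
  g.symm' _ _ _

lemma christoffel_symm {G : Model m → Matrix (Fin (m + 1)) (Fin (m + 1)) ℝ}
    (hG : ∀ y i j, G y i j = G y j i) (k i j : Fin (m + 1)) (y : Model m) :
    christoffel G k i j y = christoffel G k j i y := by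
  unfold christoffel
  congr 1
  refine Finset.sum_congr rfl fun l _ => ?_
  have : (fun z => G z i j) = fun z => G z j i := funext fun z => hG z i j
  rw [this]
  ring

/-- Around each point there are coordinates `(t, x)` such that a unit time-like field with
symmetric covariant derivative is `∂ₜ` and is orthogonal to the slices `t = const`. -/
lemma exists_adapted_chart (g : LorentzMetric m M) {u : Field m M} (hu : IsUnitTimelike g u)
    (hsymm : ∀ e ∈ charts m M, ∀ y ∈ e.target, ∀ k j : Fin (m + 1),
      g.nabla u e k j y = g.nabla u e j k y) (p : M) :
    ∃ e ∈ charts m M, p ∈ e.source ∧ ∃ δ > 0, e.target = box m δ ∧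
      ∀ y ∈ e.target, coordVec e y 0 = u (e.symm y) ∧ ∀ a : Fin m, g.comp e y 0 a.succ = 0 := by
  set e₀ := chartAt (Model m) p with he₀
  have he₀c : e₀ ∈ charts m M := IsManifold.chart_mem_maximalAtlas p
  -- This is minus the dual 1-form of `u`; the sign makes `θ(u) = 1`, because `g(u, u) = -1`.
  set θ : Model m → Model m →L[ℝ] ℝ := fun y =>
    -∑ i, g.lower u e₀ i y • (EuclideanSpace.proj (𝕜 := ℝ) i : Model m →L[ℝ] ℝ) with hθ
  have hθv : ∀ y v, θ y v = -g.val (e₀.symm y) (u (e₀.symm y))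
      (mfderiv 𝓘(ℝ, Model m) 𝓘(ℝ, Model m) e₀.symm y v) := by
    intro y v
    rw [mfderiv_symm_eq_sum, map_sum]
    simp [hθ, LorentzMetric.lower, mul_comm]
  have hθs : ContDiffOn ℝ ∞ θ e₀.target :=
    (ContDiffOn.sum fun i _ => (contDiffOn_lower g hu.1 he₀c i).smul contDiffOn_const).neg
  have hlow : ∀ y ∈ e₀.target, ∀ i, DifferentiableAt ℝ (g.lower u e₀ i) y := fun y hy i =>
    ((contDiffOn_lower g hu.1 he₀c i).contDiffAt (e₀.open_target.mem_nhds hy)).differentiableAt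
      (by simp)
  -- The Levi-Civita connection is torsion-free, so the Christoffel terms cancel on antisymmetrizing
  -- `∇u`, and the form is closed.
  have hpd : ∀ y ∈ e₀.target, ∀ k j, pd k (g.lower u e₀ j) y = pd j (g.lower u e₀ k) y := by
    intro y hy k j
    have h := hsymm e₀ he₀c y hy k j
    unfold LorentzMetric.nabla at h
    have h2 : ∀ l, christoffel (g.comp e₀) l k j y = christoffel (g.comp e₀) l j k y :=
      fun l => christoffel_symm (comp_symm g e₀) l k j y
    simp only [h2] at h
    linarith
  have hclosed : ∀ y ∈ e₀.target, ∀ v w, fderiv ℝ θ y v w = fderiv ℝ θ y w v := by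
    intro y hy
    have hfd : HasFDerivAt θ (-∑ i, (fderiv ℝ (g.lower u e₀ i) y).smulRight
        (EuclideanSpace.proj (𝕜 := ℝ) i : Model m →L[ℝ] ℝ)) y :=
      (HasFDerivAt.fun_sum fun i _ => (hlow y hy i).hasFDerivAt.smul_const _).neg
    have hexp : ∀ i (v : Model m), fderiv ℝ (g.lower u e₀ i) y v =
        ∑ j, v j * pd j (g.lower u e₀ i) y := by
      intro i v
      conv_lhs => rw [← sum_smul_stdVec v]
      rw [map_sum]
      simp [pd]
    have hval : ∀ v w : Model m, fderiv ℝ θ y v w =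
        -∑ i, ∑ j, v j * w i * pd j (g.lower u e₀ i) y := by
      intro v w
      rw [hfd.fderiv]
      have hterm : ∀ i, (fderiv ℝ (g.lower u e₀ i) y).smulRight
          (EuclideanSpace.proj (𝕜 := ℝ) i : Model m →L[ℝ] ℝ) v w =
          ∑ j, v j * w i * pd j (g.lower u e₀ i) y := by
        intro i
        change fderiv ℝ (g.lower u e₀ i) y v * w i = _
        rw [hexp, Finset.sum_mul]
        exact Finset.sum_congr rfl fun j _ => by ring
      simp only [neg_apply, sum_apply, hterm]
    intro v w
    rw [hval, hval, Finset.sum_comm]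
    congr 1
    exact Finset.sum_congr rfl fun i _ => Finset.sum_congr rfl fun j _ => by
      rw [hpd y hy i j]; ring
  have hθU : ∀ y ∈ e₀.target, θ y (chartField u e₀ y) = 1 := by
    intro y hy
    rw [hθv, mfderiv_symm_chartField he₀c hy, hu.2, neg_neg]
  have hpe : p ∈ e₀.source := mem_chart_source _ p
  obtain ⟨δ, hδ, Φ, hΦsrc, hΦt, hpΦ, hΦs, hΦsymm, hΦd⟩ := exists_flowBox e₀.open_target
    (e₀.map_source hpe) (contDiffOn_chartField hu.1 he₀c) hθs hclosed hθU
  have htarget : (e₀.trans Φ.symm).target = box m δ := by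
    ext y
    rw [OpenPartialHomeomorph.trans_target, OpenPartialHomeomorph.symm_target, hΦsrc]
    refine ⟨fun h => h.1, fun h => ⟨h, hΦt ?_⟩⟩
    exact Φ.map_source (by rw [hΦsrc]; exact h)
  refine ⟨e₀.trans Φ.symm, ?_, ?_, δ, hδ, htarget, ?_⟩
  · refine OpenPartialHomeomorph.mem_maximalAtlas_of_contMDiffOn _ ?_ ?_
    · exact (contMDiffOn_iff_contDiffOn.2 hΦsymm).comp
        ((contMDiffOn_of_mem_maximalAtlas he₀c).mono fun x hx => hx.1) fun x hx => hx.2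
    · refine (contMDiffOn_symm_of_mem_charts he₀c).comp
        ((contMDiffOn_iff_contDiffOn.2 hΦs).mono fun x hx => hx.1) fun x hx => hx.2
  · exact ⟨hpe, hpΦ⟩
  · intro y hy
    rw [htarget, ← hΦsrc] at hy
    have hΦy : Φ y ∈ e₀.target := hΦt (Φ.map_source hy)
    have hcoord : ∀ i, coordVec (e₀.trans Φ.symm) y i =
        mfderiv 𝓘(ℝ, Model m) 𝓘(ℝ, Model m) e₀.symm (Φ y) (fderiv ℝ Φ y (stdVec i)) := by
      intro i
      have h1 : MDifferentiableAt 𝓘(ℝ, Model m) 𝓘(ℝ, Model m) e₀.symm (Φ y) :=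
        (mdifferentiable_of_mem_charts he₀c).mdifferentiableAt_symm hΦy
      have h2 : DifferentiableAt ℝ Φ y :=
        (hΦs.contDiffAt (Φ.open_source.mem_nhds hy)).differentiableAt (by simp)
      have h3 := mfderiv_comp y h1 h2.mdifferentiableAt
      rw [mfderiv_eq_fderiv] at h3
      exact DFunLike.congr_fun h3 (stdVec i : Model m)
    have hu0 : coordVec (e₀.trans Φ.symm) y 0 = u ((e₀.trans Φ.symm).symm y) := by
      rw [hcoord, (hΦd y hy).1]
      exact mfderiv_symm_chartField he₀c hΦy
    refine ⟨hu0, fun a => ?_⟩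
    -- The form `θ` has become `dt`, so it vanishes on `∂_a`, and this says that `∂_a` is orthogonal
    -- to `u`.
    have h4 := (hΦd y hy).2 (stdVec a.succ)
    rw [hθv] at h4
    have h5 : (stdVec a.succ : Model m) 0 = 0 := by
      simp [stdVec]
    rw [h5, neg_eq_zero] at h4
    change g.val _ (coordVec (e₀.trans Φ.symm) y 0) (coordVec (e₀.trans Φ.symm) y a.succ) = 0
    rw [hu0, hcoord]
    exact h4

end AdaptedChart

/-! ### Christoffel symbols and Ricci tensor in adapted coordinates. -/

section Coordinates

variable {m : ℕ} {δ : ℝ} {G : Model m → Matrix (Fin (m + 1)) (Fin (m + 1)) ℝ} {φ : Model m → ℝ}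

/-- The spatial block of a matrix of metric components. -/
def spatial (G : Model m → Matrix (Fin (m + 1)) (Fin (m + 1)) ℝ) (y : Model m) :
    Matrix (Fin m) (Fin m) ℝ :=
  Matrix.of fun a b => G y a.succ b.succ

/-- A metric of the form `-dt² + g_ab dxᵃ dxᵇ` on a box. -/
structure IsAdapted (δ : ℝ) (G : Model m → Matrix (Fin (m + 1)) (Fin (m + 1)) ℝ) : Prop where
  smooth : ∀ i j, ContDiffOn ℝ ∞ (fun y => G y i j) (box m δ)
  symm : ∀ y i j, G y i j = G y j i
  zero_zero : ∀ y ∈ box m δ, G y 0 0 = -1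
  zero_succ : ∀ y ∈ box m δ, ∀ a : Fin m, G y 0 a.succ = 0
  posDef : ∀ y ∈ box m δ, (spatial G y).PosDef

/-- A metric of the form `-dt² + g_ab dxᵃ dxᵇ` with `∂ₜ g_ab = 2 φ g_ab`. -/
structure IsTorseAdapted (δ : ℝ) (G : Model m → Matrix (Fin (m + 1)) (Fin (m + 1)) ℝ)
    (φ : Model m → ℝ) : Prop extends IsAdapted δ G where
  smooth_phi : ContDiffOn ℝ ∞ φ (box m δ)
  pd_zero : ∀ y ∈ box m δ, ∀ a b : Fin m,
    pd 0 (fun z => G z a.succ b.succ) y = 2 * φ y * G y a.succ b.succ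

lemma pd_congr {F F' : Model m → ℝ} {s : Set (Model m)} (hs : IsOpen s) (h : EqOn F F' s)
    {y : Model m} (hy : y ∈ s) (i : Fin (m + 1)) : pd i F y = pd i F' y := by
  unfold pd
  rw [Filter.EventuallyEq.fderiv_eq (h.eventuallyEq_of_mem (hs.mem_nhds hy))]

lemma pd_const (c : ℝ) (y : Model m) (i : Fin (m + 1)) : pd i (fun _ => c) y = 0 := by
  simp [pd]

lemma pd_eq_zero_of_eqOn_const {F : Model m → ℝ} {s : Set (Model m)} (hs : IsOpen s) {c : ℝ}
    (h : ∀ y ∈ s, F y = c) {y : Model m} (hy : y ∈ s) (i : Fin (m + 1)) : pd i F y = 0 := by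
  rw [pd_congr hs (F' := fun _ => c) h hy, pd_const]

namespace IsAdapted

lemma differentiableAt (h : IsAdapted δ G) {y : Model m} (hy : y ∈ box m δ) (i j : Fin (m + 1)) :
    DifferentiableAt ℝ (fun y => G y i j) y :=
  ((h.smooth i j).contDiffAt ((isOpen_box δ).mem_nhds hy)).differentiableAt (by simp)

lemma succ_zero (h : IsAdapted δ G) {y : Model m} (hy : y ∈ box m δ) (a : Fin m) :
    G y a.succ 0 = 0 := by
  rw [h.symm, h.zero_succ y hy]

lemma isUnit_det_spatial (h : IsAdapted δ G) {y : Model m} (hy : y ∈ box m δ) :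
    IsUnit (spatial G y).det :=
  (h.posDef y hy).det_pos.ne'.isUnit

lemma inv_eq (h : IsAdapted δ G) {y : Model m} (hy : y ∈ box m δ) :
    (G y)⁻¹ = Matrix.of fun i j => Fin.cases (Fin.cases (-1) (fun _ => 0) j)
      (fun a => Fin.cases 0 (fun b => (spatial G y)⁻¹ a b) j) i := by
  refine Matrix.inv_eq_right_inv ?_
  have hmul := Matrix.mul_nonsing_inv _ (h.isUnit_det_spatial hy)
  ext i j
  rw [Matrix.mul_apply, Fin.sum_univ_succ]
  refine Fin.cases ?_ (fun a => ?_) i <;> refine Fin.cases ?_ (fun b => ?_) j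
  · simp [h.zero_zero y hy, h.zero_succ y hy]
  · simp [h.zero_succ y hy, (Fin.succ_ne_zero b).symm]
  · simp [h.succ_zero hy, Fin.succ_ne_zero a]
  · have := congrFun (congrFun hmul a) b
    rw [Matrix.mul_apply] at this
    simp only [spatial, Matrix.of_apply] at this
    simp [h.succ_zero hy, spatial, this, Matrix.one_apply]

lemma inv_zero_zero (h : IsAdapted δ G) {y : Model m} (hy : y ∈ box m δ) : (G y)⁻¹ 0 0 = -1 := by
  rw [h.inv_eq hy]; rfl

lemma inv_zero_succ (h : IsAdapted δ G) {y : Model m} (hy : y ∈ box m δ) (a : Fin m) :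
    (G y)⁻¹ 0 a.succ = 0 := by
  rw [h.inv_eq hy]; rfl

lemma inv_succ_zero (h : IsAdapted δ G) {y : Model m} (hy : y ∈ box m δ) (a : Fin m) :
    (G y)⁻¹ a.succ 0 = 0 := by
  rw [h.inv_eq hy]; rfl

lemma inv_succ_succ (h : IsAdapted δ G) {y : Model m} (hy : y ∈ box m δ) (a b : Fin m) :
    (G y)⁻¹ a.succ b.succ = (spatial G y)⁻¹ a b := by
  rw [h.inv_eq hy]; rfl

lemma pd_zero_zero (h : IsAdapted δ G) {y : Model m} (hy : y ∈ box m δ) (i : Fin (m + 1)) :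
    pd i (fun z => G z 0 0) y = 0 :=
  pd_eq_zero_of_eqOn_const (isOpen_box δ) h.zero_zero hy i

lemma pd_zero_succ (h : IsAdapted δ G) {y : Model m} (hy : y ∈ box m δ) (i : Fin (m + 1))
    (a : Fin m) : pd i (fun z => G z 0 a.succ) y = 0 :=
  pd_eq_zero_of_eqOn_const (isOpen_box δ) (fun z hz => h.zero_succ z hz a) hy i

lemma pd_succ_zero (h : IsAdapted δ G) {y : Model m} (hy : y ∈ box m δ) (i : Fin (m + 1))
    (a : Fin m) : pd i (fun z => G z a.succ 0) y = 0 :=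
  pd_eq_zero_of_eqOn_const (isOpen_box δ) (fun _ hz => h.succ_zero hz a) hy i

lemma christoffel_zero (h : IsAdapted δ G) {y : Model m} (hy : y ∈ box m δ) (i j : Fin (m + 1)) :
    christoffel G 0 i j y = -(1 / 2 : ℝ) * (pd i (fun z => G z 0 j) y + pd j (fun z => G z 0 i) y -
      pd 0 (fun z => G z i j) y) := by
  unfold christoffel
  rw [Fin.sum_univ_succ]
  simp only [h.inv_zero_zero hy, h.inv_zero_succ hy, zero_mul, Finset.sum_const_zero]
  ring

lemma christoffel_succ (h : IsAdapted δ G) {y : Model m} (hy : y ∈ box m δ) (c : Fin m)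
    (i j : Fin (m + 1)) :
    christoffel G c.succ i j y = (1 / 2 : ℝ) * ∑ d : Fin m, (spatial G y)⁻¹ c d *
      (pd i (fun z => G z d.succ j) y + pd j (fun z => G z d.succ i) y -
        pd d.succ (fun z => G z i j) y) := by
  unfold christoffel
  rw [Fin.sum_univ_succ]
  simp only [h.inv_succ_zero hy, h.inv_succ_succ hy, zero_mul, zero_add]

lemma christoffel_zero_zero_zero (h : IsAdapted δ G) {y : Model m} (hy : y ∈ box m δ) :
    christoffel G 0 0 0 y = 0 := by
  rw [h.christoffel_zero hy, h.pd_zero_zero hy]; ring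

lemma christoffel_zero_zero_succ (h : IsAdapted δ G) {y : Model m} (hy : y ∈ box m δ)
    (a : Fin m) : christoffel G 0 0 a.succ y = 0 := by
  rw [h.christoffel_zero hy, h.pd_zero_zero hy, h.pd_zero_succ hy]; ring

lemma christoffel_zero_succ_zero (h : IsAdapted δ G) {y : Model m} (hy : y ∈ box m δ)
    (a : Fin m) : christoffel G 0 a.succ 0 y = 0 := by
  rw [christoffel_symm h.symm, h.christoffel_zero_zero_succ hy]

lemma christoffel_zero_succ_succ (h : IsAdapted δ G) {y : Model m} (hy : y ∈ box m δ)
    (a b : Fin m) :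
    christoffel G 0 a.succ b.succ y = (1 / 2 : ℝ) * pd 0 (fun z => G z a.succ b.succ) y := by
  rw [h.christoffel_zero hy, h.pd_zero_succ hy, h.pd_zero_succ hy]; ring

lemma christoffel_succ_zero_zero (h : IsAdapted δ G) {y : Model m} (hy : y ∈ box m δ)
    (c : Fin m) : christoffel G c.succ 0 0 y = 0 := by
  rw [h.christoffel_succ hy]
  simp [h.pd_succ_zero hy, h.pd_zero_zero hy]

lemma christoffel_succ_zero_succ (h : IsAdapted δ G) {y : Model m} (hy : y ∈ box m δ)
    (c b : Fin m) : christoffel G c.succ 0 b.succ y =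
      (1 / 2 : ℝ) * ∑ d, (spatial G y)⁻¹ c d * pd 0 (fun z => G z d.succ b.succ) y := by
  rw [h.christoffel_succ hy]
  simp [h.pd_succ_zero hy, h.pd_zero_succ hy]

end IsAdapted

/-- The Ricci tensor of the spatial part of the metric, at a fixed time. -/
noncomputable def spatialRicci (G : Model m → Matrix (Fin (m + 1)) (Fin (m + 1)) ℝ) (a b : Fin m)
    (y : Model m) : ℝ :=
  ∑ c : Fin m, (pd c.succ (christoffel G c.succ a.succ b.succ) y -
      pd b.succ (christoffel G c.succ a.succ c.succ) y) +
    ∑ c : Fin m, ∑ d : Fin m,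
      (christoffel G c.succ c.succ d.succ y * christoffel G d.succ a.succ b.succ y -
        christoffel G c.succ b.succ d.succ y * christoffel G d.succ a.succ c.succ y)

namespace IsTorseAdapted

lemma differentiableAt_phi (h : IsTorseAdapted δ G φ) {y : Model m} (hy : y ∈ box m δ) :
    DifferentiableAt ℝ φ y :=
  (h.smooth_phi.contDiffAt ((isOpen_box δ).mem_nhds hy)).differentiableAt (by simp)

lemma christoffel_zero_succ_succ (h : IsTorseAdapted δ G φ) {y : Model m} (hy : y ∈ box m δ)
    (a b : Fin m) : christoffel G 0 a.succ b.succ y = φ y * G y a.succ b.succ := by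
  rw [h.toIsAdapted.christoffel_zero_succ_succ hy, h.pd_zero y hy]; ring

lemma christoffel_succ_zero_succ (h : IsTorseAdapted δ G φ) {y : Model m} (hy : y ∈ box m δ)
    (c b : Fin m) : christoffel G c.succ 0 b.succ y = if c = b then φ y else 0 := by
  rw [h.toIsAdapted.christoffel_succ_zero_succ hy]
  simp only [h.pd_zero y hy]
  have hmul := congrFun (congrFun (Matrix.nonsing_inv_mul _ (h.isUnit_det_spatial hy)) c) b
  rw [Matrix.mul_apply, Matrix.one_apply] at hmul
  have : ∑ d, (spatial G y)⁻¹ c d * (2 * φ y * G y d.succ b.succ) =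
      2 * φ y * ∑ d, (spatial G y)⁻¹ c d * spatial G y d b := by
    rw [Finset.mul_sum]
    exact Finset.sum_congr rfl fun d _ => by simp only [spatial, Matrix.of_apply]; ring
  rw [this, hmul]
  split_ifs <;> ring

lemma christoffel_succ_succ_zero (h : IsTorseAdapted δ G φ) {y : Model m} (hy : y ∈ box m δ)
    (c b : Fin m) : christoffel G c.succ b.succ 0 y = if c = b then φ y else 0 := by
  rw [christoffel_symm h.symm, h.christoffel_succ_zero_succ hy]

lemma pd_christoffel_succ_zero_succ (h : IsTorseAdapted δ G φ) {y : Model m} (hy : y ∈ box m δ)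
    (c b : Fin m) (i : Fin (m + 1)) :
    pd i (christoffel G c.succ 0 b.succ) y = if c = b then pd i φ y else 0 := by
  rw [pd_congr (isOpen_box δ) (fun _ hz => h.christoffel_succ_zero_succ hz c b) hy]
  split_ifs
  · rfl
  · exact pd_const 0 y i

/-- Since `Γᶜ_{0b} = φ δᶜ_b`, the divergence term contributes `∂_a φ`, the derivative of the trace
contributes `-m ∂_a φ`, and the quadratic terms cancel. For a Ricci eigenvector `∂ₜ` and `m ≠ 1`
this makes `φ` constant on slices. -/
lemma ricci_zero_succ (h : IsTorseAdapted δ G φ) {y : Model m} (hy : y ∈ box m δ) (a : Fin m) :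
    ricciOf G 0 a.succ y = (1 - m) * pd a.succ φ y := by
  have hA := h.toIsAdapted
  have h1 : ∀ i, pd i (christoffel G 0 0 a.succ) y = 0 := fun i =>
    pd_eq_zero_of_eqOn_const (isOpen_box δ) (fun z hz => hA.christoffel_zero_zero_succ hz a) hy i
  have h2 : ∀ i, pd i (christoffel G 0 0 0) y = 0 := fun i =>
    pd_eq_zero_of_eqOn_const (isOpen_box δ) (fun z hz => hA.christoffel_zero_zero_zero hz) hy i
  have hsym : ∀ c d : Fin m, christoffel G c.succ d.succ a.succ y =
      christoffel G c.succ a.succ d.succ y := fun c d => christoffel_symm h.symm _ _ _ _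
  unfold ricciOf
  simp only [Fin.sum_univ_succ, h1, h2, h.pd_christoffel_succ_zero_succ hy,
    hA.christoffel_zero_zero_succ hy, hA.christoffel_zero_zero_zero hy,
    hA.christoffel_zero_succ_zero hy, hA.christoffel_succ_zero_zero hy,
    h.christoffel_succ_zero_succ hy]
  simp [Finset.sum_sub_distrib, hsym]
  ring

lemma ricci_zero_zero (h : IsTorseAdapted δ G φ) {y : Model m} (hy : y ∈ box m δ) :
    ricciOf G 0 0 y = -(m * pd 0 φ y) - m * φ y ^ 2 := by
  have hA := h.toIsAdapted
  have h2 : ∀ i, pd i (christoffel G 0 0 0) y = 0 := fun i =>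
    pd_eq_zero_of_eqOn_const (isOpen_box δ) (fun z hz => hA.christoffel_zero_zero_zero hz) hy i
  have h3 : ∀ i (c : Fin m), pd i (christoffel G c.succ 0 0) y = 0 := fun i c =>
    pd_eq_zero_of_eqOn_const (isOpen_box δ) (fun z hz => hA.christoffel_succ_zero_zero hz c) hy i
  unfold ricciOf
  simp only [Fin.sum_univ_succ, h2, h3, h.pd_christoffel_succ_zero_succ hy,
    hA.christoffel_zero_zero_succ hy, hA.christoffel_zero_zero_zero hy,
    hA.christoffel_succ_zero_zero hy,
    h.christoffel_succ_zero_succ hy]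
  simp
  ring

/-- The term `∂ₜ Γ⁰_ab = ∂ₜ(φ g_ab)` gives `φ' + 2φ²`; the quadratic terms with an index `0` add `(m
- 2) φ²`. -/
lemma ricci_succ_succ (h : IsTorseAdapted δ G φ) {y : Model m} (hy : y ∈ box m δ) (a b : Fin m) :
    ricciOf G a.succ b.succ y =
      (pd 0 φ y + m * φ y ^ 2) * G y a.succ b.succ + spatialRicci G a b y := by
  have hA := h.toIsAdapted
  have h1 : pd 0 (christoffel G 0 a.succ b.succ) y =
      pd 0 φ y * G y a.succ b.succ + 2 * φ y ^ 2 * G y a.succ b.succ := by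
    rw [pd_congr (isOpen_box δ) (fun z hz => h.christoffel_zero_succ_succ hz a b) hy]
    have hd := (h.differentiableAt_phi hy).hasFDerivAt.fun_mul
      (hA.differentiableAt hy a.succ b.succ).hasFDerivAt
    have hp := h.pd_zero y hy a b
    unfold pd at hp ⊢
    rw [hd.fderiv]
    simp only [add_apply, smul_apply, smul_eq_mul, hp]
    ring
  have h2 : ∀ i, pd i (christoffel G 0 a.succ 0) y = 0 := fun i =>
    pd_eq_zero_of_eqOn_const (isOpen_box δ) (fun z hz => hA.christoffel_zero_succ_zero hz a) hy i
  unfold ricciOf spatialRicci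
  simp only [Fin.sum_univ_succ, h1, h2,
    hA.christoffel_zero_zero_succ hy, hA.christoffel_zero_zero_zero hy,
    hA.christoffel_zero_succ_zero hy, h.christoffel_zero_succ_succ hy,
    h.christoffel_succ_succ_zero hy, Finset.sum_sub_distrib, Finset.sum_add_distrib]
  simp [h.symm y b.succ a.succ]
  ring

end IsTorseAdapted

end Coordinates

/-! ### The warping function, and the time dependence of warped metrics and their Ricci tensor. -/

section Warp

variable {m : ℕ} {δ : ℝ} {G : Model m → Matrix (Fin (m + 1)) (Fin (m + 1)) ℝ} {φ : Model m → ℝ}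

lemma eq_of_hasDerivAt_zero {f : ℝ → ℝ} {s : Set ℝ} (hs : Convex ℝ s) (hso : IsOpen s)
    (hf : ∀ t ∈ s, HasDerivAt f 0 t) {t t' : ℝ} (ht : t ∈ s) (ht' : t' ∈ s) : f t = f t' :=
  hs.is_const_of_fderivWithin_eq_zero (𝕜 := ℝ)
    (fun t ht => (hf t ht).differentiableAt.differentiableWithinAt)
    (fun t ht => by
      rw [fderivWithin_of_isOpen hso ht]
      ext
      simp [(hf t ht).deriv]) ht ht'

lemma slice_eq_add (t : ℝ) (x : EuclideanSpace ℝ (Fin m)) :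
    slice t x = slice 0 x + t • (stdVec 0 : Model m) := by
  ext i
  refine Fin.cases ?_ (fun a => ?_) i <;> simp [stdVec]

lemma hasDerivAt_slice {F : Model m → ℝ} {t : ℝ} {x : EuclideanSpace ℝ (Fin m)}
    (hF : DifferentiableAt ℝ F (slice t x)) :
    HasDerivAt (fun t => F (slice t x)) (pd 0 F (slice t x)) t := by
  have h1 : HasDerivAt (fun t : ℝ => slice t x) (stdVec 0 : Model m) t := by
    have h2 : (fun t : ℝ => slice t x) = fun t => slice 0 x + t • (stdVec 0 : Model m) :=
      funext fun t => slice_eq_add t x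
    rw [h2]
    simpa using ((hasDerivAt_id t).smul_const (stdVec 0 : Model m)).const_add (slice 0 x)
  exact hF.hasFDerivAt.comp_hasDerivAt t h1

lemma slice_mem_box {t : ℝ} {x : EuclideanSpace ℝ (Fin m)} (ht : t ∈ Ioo (-δ) δ)
    (hx : x ∈ Metric.ball 0 δ) : slice t x ∈ box m δ :=
  ⟨ht, by rwa [spacePart_slice]⟩

/-- The projection of a point to the slice `t = 0`. -/
def base (y : Model m) : Model m := slice 0 (spacePart y)

lemma zero_mem_Ioo (hδ : 0 < δ) : (0 : ℝ) ∈ Ioo (-δ) δ := ⟨by simpa using hδ, hδ⟩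

lemma base_mem_box (hδ : 0 < δ) {y : Model m} (hy : y ∈ box m δ) : base y ∈ box m δ :=
  slice_mem_box (zero_mem_Ioo hδ) hy.2

lemma base_eq_add (y : Model m) : base y = y + (-(y 0)) • (stdVec 0 : Model m) := by
  have h : y = base y + y 0 • (stdVec 0 : Model m) := by
    conv_lhs => rw [← slice_spacePart y, slice_eq_add (y 0)]
    rfl
  rw [neg_smul, ← sub_eq_add_neg, eq_sub_iff_add_eq]
  exact h.symm

lemma base_add_smul (y : Model m) (s : ℝ) : base (y + s • (stdVec 0 : Model m)) = base y := by
  unfold base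
  congr 1
  ext a
  simp [stdVec]

lemma base_add_smul_succ (y : Model m) (s : ℝ) (c : Fin m) :
    base (y + s • (stdVec c.succ : Model m)) = base y + s • (stdVec c.succ : Model m) := by
  rw [base_eq_add, base_eq_add]
  have : (y + s • (stdVec c.succ : Model m)) 0 = y 0 := by simp [stdVec]
  rw [this]
  abel

/-- Derivatives of a function which does not depend on the time do not depend on the time. -/
lemma pd_of_static (hδ : 0 < δ) {F : Model m → ℝ} (hF : ∀ y ∈ box m δ, F y = F (base y))
    {y : Model m} (hy : y ∈ box m δ) (i : Fin (m + 1)) : pd i F y = pd i F (base y) := by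
  set v : Model m := (-(y 0)) • (stdVec 0 : Model m) with hv
  have hb : base y = y + v := base_eq_add y
  have h1 : F =ᶠ[𝓝 y] fun z => F (z + v) := by
    have hc : ContinuousAt (fun z : Model m => z + v) y := by fun_prop
    have h2 : ∀ᶠ z in 𝓝 y, z + v ∈ box m δ :=
      hc.eventually_mem ((isOpen_box δ).mem_nhds (by
        have := base_mem_box hδ hy
        rwa [hb] at this))
    filter_upwards [h2, (isOpen_box δ).mem_nhds hy] with z hz1 hz2
    rw [hF z hz2, hF _ hz1, hv, base_add_smul]
  unfold pd
  rw [h1.fderiv_eq, fderiv_comp_add_right, hb]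

/-- Moving in a spatial direction leaves `y 0` fixed and commutes with `base`, so `r (y 0)` is a
constant factor along the line and no regularity of `r` is needed. -/
lemma pd_succ_of_scaling (hδ : 0 < δ) {F : Model m → ℝ} {r : ℝ → ℝ}
    (hd : ∀ y ∈ box m δ, DifferentiableAt ℝ F y)
    (hF : ∀ y ∈ box m δ, F y = r (y 0) * F (base y))
    {y : Model m} (hy : y ∈ box m δ) (c : Fin m) :
    pd c.succ F y = r (y 0) * pd c.succ F (base y) := by
  have hline : ∀ z ∈ box m δ,
      HasDerivAt (fun s : ℝ => F (z + s • (stdVec c.succ : Model m))) (pd c.succ F z) 0 := by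
    intro z hz
    have h1 : HasDerivAt (fun s : ℝ => z + s • (stdVec c.succ : Model m)) (stdVec c.succ) 0 := by
      simpa using ((hasDerivAt_id (0 : ℝ)).smul_const (stdVec c.succ : Model m)).const_add z
    have h2 : HasFDerivAt F (fderiv ℝ F z) (z + (0 : ℝ) • (stdVec c.succ : Model m)) := by
      rw [zero_smul, add_zero]
      exact (hd z hz).hasFDerivAt
    exact h2.comp_hasDerivAt (0 : ℝ) h1
  refine (hline y hy).unique (((hline _ (base_mem_box hδ hy)).const_mul
    (r (y 0))).congr_of_eventuallyEq ?_)
  have hc : ContinuousAt (fun s : ℝ => y + s • (stdVec c.succ : Model m)) 0 := by fun_prop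
  have h2 : ∀ᶠ s in 𝓝 (0 : ℝ), y + s • (stdVec c.succ : Model m) ∈ box m δ :=
    hc.eventually_mem ((isOpen_box δ).mem_nhds (by simpa using hy))
  filter_upwards [h2] with s hs
  have h0 : (y + s • (stdVec c.succ : Model m)) 0 = y 0 := by simp [stdVec]
  rw [hF _ hs, h0, base_add_smul_succ]

namespace IsTorseAdapted

/-- A function with vanishing spatial derivatives depends only on the time. -/
lemma phi_eq (h : IsTorseAdapted δ G φ) (hφ : ∀ y ∈ box m δ, ∀ a : Fin m, pd a.succ φ y = 0)
    {y : Model m} (hy : y ∈ box m δ) : φ y = φ (slice (y 0) 0) := by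
  have hδ : 0 < δ := by linarith [hy.1.1, hy.1.2]
  obtain ⟨t, x₀, ht, hx₀, rfl⟩ : ∃ t x, t ∈ Ioo (-δ) δ ∧ x ∈ Metric.ball 0 δ ∧ y = slice t x :=
    ⟨y 0, spacePart y, hy.1, hy.2, (slice_spacePart y).symm⟩
  rw [slice_zero]
  have hfd : ∀ x ∈ Metric.ball (0 : EuclideanSpace ℝ (Fin m)) δ,
      HasFDerivAt (fun x => φ (slice t x)) (0 : EuclideanSpace ℝ (Fin m) →L[ℝ] ℝ) x := by
    intro x hx
    have hmem := slice_mem_box ht hx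
    have h1 : DifferentiableAt ℝ (fun x : EuclideanSpace ℝ (Fin m) => slice t x) x :=
      (contDiff_slice.comp (contDiff_const.prodMk contDiff_id)).differentiable (by simp) x
    have h2 := (h.differentiableAt_phi hmem).hasFDerivAt.comp x h1.hasFDerivAt
    convert! h2 using 1
    ext w
    -- Tangent vectors to a slice have no time component, so only the vanishing spatial derivatives
    -- of `φ` enter.
    have h3 : fderiv ℝ (fun x : EuclideanSpace ℝ (Fin m) => slice t x) x w 0 = 0 := by
      have h4 := ((EuclideanSpace.proj (𝕜 := ℝ) (0 : Fin (m + 1)) :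
        Model m →L[ℝ] ℝ).hasFDerivAt (x := slice t x)).comp x h1.hasFDerivAt
      exact DFunLike.congr_fun (h4.unique (hasFDerivAt_const t x)) w
    set v := fderiv ℝ (fun x : EuclideanSpace ℝ (Fin m) => slice t x) x w with hv
    have h5 : fderiv ℝ φ (slice t x) v = ∑ i, v i * pd i φ (slice t x) := by
      conv_lhs => rw [← sum_smul_stdVec v]
      rw [map_sum]
      simp [pd]
    change 0 = fderiv ℝ φ (slice t x) v
    rw [h5, Fin.sum_univ_succ, h3]
    simp [hφ (slice t x) hmem]
  have := (convex_ball (0 : EuclideanSpace ℝ (Fin m)) δ).is_const_of_fderivWithin_eq_zero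
    (𝕜 := ℝ) (fun x hx => (hfd x hx).differentiableAt.differentiableWithinAt)
    (fun x hx => by rw [fderivWithin_of_isOpen Metric.isOpen_ball hx, (hfd x hx).fderiv])
    hx₀ (Metric.mem_ball_self hδ)
  exact this

/-- The warping function. -/
lemma exists_warp (h : IsTorseAdapted δ G φ) (hδ : 0 < δ)
    (hφ : ∀ y ∈ box m δ, ∀ a : Fin m, pd a.succ φ y = 0) :
    ∃ f : ℝ → ℝ, ContDiffOn ℝ ∞ f (Ioo (-δ) δ) ∧ (∀ t, 0 < f t) ∧ f 0 = 1 ∧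
      (∀ t ∈ Ioo (-δ) δ, HasDerivAt f (φ (slice t 0) * f t) t) ∧
      ∀ y ∈ box m δ, ∀ a b : Fin m,
        G y a.succ b.succ = f (y 0) ^ 2 * G (base y) a.succ b.succ := by
  have h0 : (0 : EuclideanSpace ℝ (Fin m)) ∈ Metric.ball (0 : EuclideanSpace ℝ (Fin m)) δ :=
    Metric.mem_ball_self hδ
  set ψ : ℝ → ℝ := fun t => φ (slice t 0) with hψ
  have hψs : ContDiffOn ℝ ∞ ψ (Ioo (-δ) δ) :=
    h.smooth_phi.comp (contDiff_slice.comp (contDiff_id.prodMk contDiff_const)).contDiffOn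
      fun t ht => slice_mem_box ht h0
  obtain ⟨Ψ, hΨ⟩ := (convex_Ioo (-δ) δ).exists_forall_hasDerivWithinAt (𝕜 := ℝ)
    (hψs.differentiableOn (by simp))
  have hΨd : ∀ t ∈ Ioo (-δ) δ, HasDerivAt Ψ (ψ t) t := fun t ht =>
    (hΨ t ht).hasDerivAt (isOpen_Ioo.mem_nhds ht)
  have hΨs : ContDiffOn ℝ ∞ Ψ (Ioo (-δ) δ) := by
    rw [contDiffOn_infty_iff_deriv_of_isOpen isOpen_Ioo]
    exact ⟨fun t ht => (hΨd t ht).differentiableAt.differentiableWithinAt,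
      hψs.congr fun t ht => (hΨd t ht).deriv⟩
  -- The solution of `f' = φ f` with `f 0 = 1`; this normalization makes the fibre metric the one
  -- induced on the slice `t = 0`.
  set f : ℝ → ℝ := fun t => Real.exp (Ψ t - Ψ 0) with hf
  have hfd : ∀ t ∈ Ioo (-δ) δ, HasDerivAt f (ψ t * f t) t := by
    intro t ht
    have := ((hΨd t ht).sub_const (Ψ 0)).exp
    rwa [mul_comm] at this
  have hf0 : f 0 = 1 := by simp [hf]
  refine ⟨f, (hΨs.sub contDiffOn_const).exp, fun t => Real.exp_pos _, hf0, hfd, ?_⟩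
  intro y hy a b
  set x := spacePart y with hx
  -- Both `g_ab` and `f²` satisfy `w' = 2 φ w`, so their quotient is constant in time.
  have hconst := eq_of_hasDerivAt_zero (f := fun t => G (slice t x) a.succ b.succ / f t ^ 2)
    (convex_Ioo (-δ) δ) isOpen_Ioo (fun t ht => by
      have hmem := slice_mem_box ht hy.2
      have h1 := hasDerivAt_slice (h.toIsAdapted.differentiableAt hmem a.succ b.succ)
      rw [h.pd_zero _ hmem, h.phi_eq hφ hmem] at h1
      have hft : f t ≠ 0 := (Real.exp_pos _).ne'
      have h2 := h1.fun_div ((hfd t ht).fun_pow 2) (pow_ne_zero 2 hft)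
      convert! h2 using 1
      simp only [slice_zero]
      field_simp
      simp only [hψ]
      ring) hy.1 (zero_mem_Ioo hδ)
  simp only [hf0, one_pow, div_one, hx, slice_spacePart] at hconst
  rw [div_eq_iff (pow_ne_zero 2 (Real.exp_pos _).ne')] at hconst
  rw [hconst, mul_comm]
  rfl

end IsTorseAdapted

/-- A metric of the form `-dt² + f(t)² h_ab dxᵃ dxᵇ`. -/
structure IsWarped (δ : ℝ) (G : Model m → Matrix (Fin (m + 1)) (Fin (m + 1)) ℝ)
    (φ : Model m → ℝ) (f : ℝ → ℝ) : Prop extends IsTorseAdapted δ G φ where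
  pos : 0 < δ
  pd_succ : ∀ y ∈ box m δ, ∀ a : Fin m, pd a.succ φ y = 0
  warp_pos : ∀ t, 0 < f t
  warp_zero : f 0 = 1
  hasDerivAt_warp : ∀ t ∈ Ioo (-δ) δ, HasDerivAt f (φ (slice t 0) * f t) t
  eq_warp : ∀ y ∈ box m δ, ∀ a b : Fin m,
    G y a.succ b.succ = f (y 0) ^ 2 * G (base y) a.succ b.succ

namespace IsWarped

variable {f : ℝ → ℝ}

lemma spatial_eq (h : IsWarped δ G φ f) {y : Model m} (hy : y ∈ box m δ) :
    spatial G y = f (y 0) ^ 2 • spatial G (base y) := by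
  ext a b
  simp [spatial, h.eq_warp y hy a b]

lemma inv_spatial_eq (h : IsWarped δ G φ f) {y : Model m} (hy : y ∈ box m δ) :
    (spatial G y)⁻¹ = (f (y 0) ^ 2)⁻¹ • (spatial G (base y))⁻¹ := by
  have hf : f (y 0) ^ 2 ≠ 0 := pow_ne_zero 2 (h.warp_pos _).ne'
  refine Matrix.inv_eq_right_inv ?_
  rw [h.spatial_eq hy, Matrix.smul_mul, Matrix.mul_smul, smul_smul, mul_inv_cancel₀ hf, one_smul,
    Matrix.mul_nonsing_inv _ (h.isUnit_det_spatial (base_mem_box h.pos hy))]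

/-- On a slice `f²` is a constant conformal factor: it cancels between the inverse metric and the
derivatives of the metric. -/
lemma christoffel_static (h : IsWarped δ G φ f) {y : Model m} (hy : y ∈ box m δ)
    (c a b : Fin m) :
    christoffel G c.succ a.succ b.succ y = christoffel G c.succ a.succ b.succ (base y) := by
  have hb := base_mem_box h.pos hy
  have hf : f (y 0) ≠ 0 := (h.warp_pos _).ne'
  have hpd : ∀ i j k : Fin m, pd k.succ (fun z => G z i.succ j.succ) y =
      f (y 0) ^ 2 * pd k.succ (fun z => G z i.succ j.succ) (base y) := fun i j k =>
    pd_succ_of_scaling (r := fun t => f t ^ 2) h.pos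
      (fun z hz => h.toIsAdapted.differentiableAt hz _ _)
      (fun z hz => h.eq_warp z hz i j) hy k
  rw [h.toIsAdapted.christoffel_succ hy, h.toIsAdapted.christoffel_succ hb, h.inv_spatial_eq hy]
  congr 1
  refine Finset.sum_congr rfl fun d _ => ?_
  rw [hpd, hpd, hpd, Matrix.smul_apply, smul_eq_mul]
  field_simp

lemma spatialRicci_static (h : IsWarped δ G φ f) {y : Model m} (hy : y ∈ box m δ) (a b : Fin m) :
    spatialRicci G a b y = spatialRicci G a b (base y) := by
  have h1 : ∀ c a b i, pd i (christoffel G (Fin.succ c) (Fin.succ a) (Fin.succ b)) y =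
      pd i (christoffel G (Fin.succ c) (Fin.succ a) (Fin.succ b)) (base y) := fun c a b i =>
    pd_of_static h.pos (fun z hz => h.christoffel_static hz c a b) hy i
  unfold spatialRicci
  simp only [h1, h.christoffel_static hy]

/-- If the Ricci tensor is `α g + T` with `T(∂ₜ, ·) = 0`, then `T` does not depend on the time. -/
lemma static_of_ricci_eq (h : IsWarped δ G φ f) (hm : m ≠ 0) {α : ℝ}
    {T : Model m → Matrix (Fin (m + 1)) (Fin (m + 1)) ℝ}
    (hR : ∀ y ∈ box m δ, ∀ i j, ricciOf G i j y = α * G y i j + T y i j)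
    (hT : ∀ y ∈ box m δ, T y 0 0 = 0) {y : Model m} (hy : y ∈ box m δ) (a b : Fin m) :
    T y a.succ b.succ = T (base y) a.succ b.succ := by
  have hm' : (m : ℝ) ≠ 0 := Nat.cast_ne_zero.2 hm
  -- The `tt` component: `T 0 0 = 0` and `g_00 = -1`.
  have hphi' : ∀ z ∈ box m δ, m * pd 0 φ z = α - m * φ z ^ 2 := by
    intro z hz
    have h1 := h.ricci_zero_zero hz
    rw [hR z hz, hT z hz, h.zero_zero z hz] at h1
    linarith
  have hTab : ∀ z ∈ box m δ, m * T z a.succ b.succ =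
      (m - 1) * (m * φ z ^ 2 - α) * G z a.succ b.succ + m * spatialRicci G a b z := by
    intro z hz
    have h1 := h.ricci_succ_succ hz a b
    rw [hR z hz] at h1
    have h2 := hphi' z hz
    have h3 : T z a.succ b.succ =
      (pd 0 φ z + m * φ z ^ 2 - α) * G z a.succ b.succ + spatialRicci G a b z := by
      linarith
    rw [h3]
    linear_combination G z a.succ b.succ * h2
  have h0 : (0 : EuclideanSpace ℝ (Fin m)) ∈ Metric.ball (0 : EuclideanSpace ℝ (Fin m)) δ :=
    Metric.mem_ball_self h.pos
  -- After eliminating `φ'`, the only possibly time-dependent part of `m T_ab` is a multiple of `f²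
  -- (m φ² - α)`. Its derivative is `2 f² φ (m φ' + m φ² - α)`, which vanishes by the `tt` equation.
  have hconst := eq_of_hasDerivAt_zero
    (f := fun t => f t ^ 2 * (m * φ (slice t 0) ^ 2 - α))
    (convex_Ioo (-δ) δ) isOpen_Ioo (fun t ht => by
      have hmem := slice_mem_box ht h0
      have h1 := hasDerivAt_slice (h.differentiableAt_phi hmem)
      have h2 := ((h.hasDerivAt_warp t ht).fun_pow 2).fun_mul
        (((h1.fun_pow 2).const_mul (m : ℝ)).sub_const α)
      convert! h2 using 1
      have h3 := hphi' _ hmem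
      simp only [Nat.cast_ofNat, Nat.add_one_sub_one, pow_one]
      linear_combination (-2 * f t ^ 2 * φ (slice t 0)) * h3) hy.1 (zero_mem_Ioo h.pos)
  have hb := base_mem_box h.pos hy
  have hby : base y 0 = 0 := rfl
  refine mul_left_cancel₀ hm' ?_
  rw [hTab y hy, hTab _ hb, h.spatialRicci_static hy, h.eq_warp y hy, h.phi_eq h.pd_succ hy,
    h.phi_eq h.pd_succ hb, hby]
  simp only [h.warp_zero, one_pow, one_mul] at hconst
  linear_combination (m - 1) * G (base y) a.succ b.succ * hconst

/-- The trace of the square of `g⁻¹ T`, for a static `T` with `T(∂ₜ, ·) = 0`, scales with the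
warping function. -/
lemma trace_sq_scaling (h : IsWarped δ G φ f) {T : Model m → Matrix (Fin (m + 1)) (Fin (m + 1)) ℝ}
    (hT0 : ∀ y ∈ box m δ, ∀ j, T y 0 j = 0) (hT0' : ∀ y ∈ box m δ, ∀ j, T y j 0 = 0)
    (hTs : ∀ y ∈ box m δ, ∀ a b : Fin m, T y a.succ b.succ = T (base y) a.succ b.succ)
    {y : Model m} (hy : y ∈ box m δ) :
    (((G (base y))⁻¹ * T (base y)) * ((G (base y))⁻¹ * T (base y))).trace =
      f (y 0) ^ 4 * (((G y)⁻¹ * T y) * ((G y)⁻¹ * T y)).trace := by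
  have hf : f (y 0) ≠ 0 := (h.warp_pos _).ne'
  have hb := base_mem_box h.pos hy
  have hN0 : ∀ z ∈ box m δ, ∀ j, ((G z)⁻¹ * T z) 0 j = 0 := by
    intro z hz j
    rw [Matrix.mul_apply, Fin.sum_univ_succ, hT0 z hz]
    simp [h.toIsAdapted.inv_zero_succ hz]
  have hN0' : ∀ z ∈ box m δ, ∀ j, ((G z)⁻¹ * T z) j 0 = 0 := by
    intro z hz j
    rw [Matrix.mul_apply]
    simp [hT0' z hz]
  -- Here `T` is static and the inverse spatial metric carries `f⁻²`, so `g⁻¹ T` scales by `f⁻²` and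
  -- the trace of its square by `f⁻⁴`.
  have hN : ∀ c d : Fin m, ((G (base y))⁻¹ * T (base y)) c.succ d.succ =
      f (y 0) ^ 2 * ((G y)⁻¹ * T y) c.succ d.succ := by
    intro c d
    rw [Matrix.mul_apply, Matrix.mul_apply, Fin.sum_univ_succ, Fin.sum_univ_succ,
      h.toIsAdapted.inv_succ_zero hb, h.toIsAdapted.inv_succ_zero hy, zero_mul, zero_mul,
      zero_add, zero_add, Finset.mul_sum]
    refine Finset.sum_congr rfl fun l _ => ?_
    rw [h.toIsAdapted.inv_succ_succ hb, h.toIsAdapted.inv_succ_succ hy, h.inv_spatial_eq hy,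
      hTs y hy, Matrix.smul_apply, smul_eq_mul]
    field_simp
  generalize hM : (G (base y))⁻¹ * T (base y) = M at hN
  generalize hM' : (G y)⁻¹ * T y = M' at hN
  have e1 := hN0 _ hb
  have e2 := hN0' _ hb
  have e3 := hN0 _ hy
  have e4 := hN0' _ hy
  rw [hM] at e1 e2
  rw [hM'] at e3 e4
  simp only [Matrix.trace, Matrix.diag, Matrix.mul_apply, Fin.sum_univ_succ, e1, e2, e3, e4, hN,
    mul_zero, zero_add, Finset.sum_const_zero, Finset.mul_sum]
  exact Finset.sum_congr rfl fun a _ => Finset.sum_congr rfl fun b _ => by ring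

/-- A warped metric is a product as soon as the fourth power of the warping function is
constant. -/
lemma phi_eq_zero (h : IsWarped δ G φ f) (hf : ∀ y ∈ box m δ, f (y 0) ^ 4 = 1) {y : Model m}
    (hy : y ∈ box m δ) : φ y = 0 := by
  have hf1 : ∀ t ∈ Ioo (-δ) δ, f t = 1 := by
    intro t ht
    have h1 := hf (slice t 0) (slice_mem_box ht (Metric.mem_ball_self h.pos))
    rw [slice_zero] at h1
    exact (pow_eq_one_iff_of_nonneg (h.warp_pos t).le (by norm_num)).1 h1
  have h2 : HasDerivAt f 0 (y 0) := by
    refine (hasDerivAt_const (y 0) (1 : ℝ)).congr_of_eventuallyEq ?_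
    filter_upwards [isOpen_Ioo.mem_nhds hy.1] with t ht
    exact hf1 t ht
  have h3 := (h.hasDerivAt_warp _ hy.1).unique h2
  rw [hf1 _ hy.1, mul_one] at h3
  rw [h.phi_eq h.pd_succ hy, h3]

end IsWarped

end Warp

/-! ### Lorentzian linear algebra and the local GRW structure. -/

section Assembly

variable {m : ℕ} {M : Type*} [TopologicalSpace M] [ChartedSpace (Model m) M]
  [IsManifold 𝓘(ℝ, Model m) ∞ M]

/-- A Lorentzian metric is positive definite on the orthogonal complement of a time-like vector. -/
lemma LorentzMetric.pos_of_orthogonal (g : LorentzMetric m M) {p : M}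
    {v w : TangentSpace 𝓘(ℝ, Model m) p} (hv : g.val p v v < 0) (hvw : g.val p v w = 0)
    (hw : w ≠ 0) : 0 < g.val p w w := by
  obtain ⟨τ, hτ, hpos⟩ := g.lorentz p
  have hwv : g.val p w v = 0 := by rw [g.symm', hvw]
  by_cases h0 : g.val p τ w = 0
  · exact hpos w h0 hw
  -- The combination of `v` and `w` orthogonal to `τ`. It is space-like, and since `v` contributes a
  -- negative amount to `g(z, z)`, the contribution of `w` has to be positive.
  set z := g.val p τ w • v - g.val p τ v • w with hz
  have hτz : g.val p τ z = 0 := by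
    simp only [hz, map_sub, map_smul, smul_eq_mul]; ring
  have hvz : g.val p v z = g.val p τ w * g.val p v v := by
    simp [hz, hvw]
  have hz0 : z ≠ 0 := by
    intro h
    rw [h, map_zero] at hvz
    exact mul_ne_zero h0 hv.ne hvz.symm
  have hzz : g.val p z z = g.val p τ w ^ 2 * g.val p v v + g.val p τ v ^ 2 * g.val p w w := by
    simp only [hz, map_sub, map_smul, smul_eq_mul, sub_apply, smul_apply, hvw, hwv]
    ring
  have h1 := hpos z hτz hz0
  rw [hzz] at h1
  have h2 : g.val p τ w ^ 2 * g.val p v v < 0 := mul_neg_of_pos_of_neg (by positivity) hv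
  by_contra hneg
  have h3 : g.val p τ v ^ 2 * g.val p w w ≤ 0 :=
    mul_nonpos_of_nonneg_of_nonpos (sq_nonneg _) (not_lt.1 hneg)
  linarith

/-- A space-time with two orthonormal space-like fields and a time-like field has dimension at
least three. -/
lemma two_le_of_orthonormalPair (g : LorentzMetric m M) {A B u : Field m M}
    (hAB : IsOrthonormalPair g A B) (hu : IsUnitTimelike g u) (p : M) : 2 ≤ m := by
  obtain ⟨-, -, hA, hB, hAB⟩ := hAB
  have hli : LinearIndependent ℝ (![u p, A p, B p] : Fin 3 → Model m) := by
    rw [Fintype.linearIndependent_iff]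
    intro c hc
    rw [Fin.sum_univ_three] at hc
    have hc' : c 0 • u p + c 1 • A p + c 2 • B p = 0 := hc
    have e1 := congrArg (g.val p (u p)) hc'
    have e2 := congrArg (g.val p (A p)) hc'
    have e3 := congrArg (g.val p (B p)) hc'
    simp only [map_add, map_smul, smul_eq_mul, map_zero, hA p, hB p, hu.2 p, hAB p,
      g.symm' p (A p) (u p), g.symm' p (B p) (u p), g.symm' p (B p) (A p)] at e1 e2 e3
    -- The vector `u` need not be orthogonal to `A` and `B`; eliminating `c 1` and `c 2` leaves `c
    -- 0` times a factor that is at least `1`.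
    have h0 : c 0 * (1 + g.val p (u p) (A p) ^ 2 + g.val p (u p) (B p) ^ 2) = 0 := by
      linear_combination -e1 + g.val p (u p) (A p) * e2 + g.val p (u p) (B p) * e3
    have h00 : c 0 = 0 := (mul_eq_zero.1 h0).resolve_right (by positivity)
    rw [h00] at e2 e3
    intro i
    fin_cases i
    · exact h00
    · simpa using e2
    · simpa using e3
  have h := hli.fintype_card_le_finrank
  simp only [Fintype.card_fin, finrank_euclideanSpace_fin] at h
  omega

lemma lower_eq_comp (g : LorentzMetric m M) {u : Field m M}
    {e : OpenPartialHomeomorph M (Model m)} {y : Model m}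
    (h : coordVec e y 0 = u (e.symm y)) (j : Fin (m + 1)) : g.lower u e j y = g.comp e y 0 j := by
  unfold LorentzMetric.lower LorentzMetric.comp
  rw [Matrix.of_apply, h]

/-- Positivity of the spatial block is Lorentzian: a nonzero combination of the `∂_a` is orthogonal
to the time-like `u`, hence space-like. -/
lemma isAdapted_comp (g : LorentzMetric m M) {u : Field m M} (hu : IsUnitTimelike g u)
    {e : OpenPartialHomeomorph M (Model m)} (he : e ∈ charts m M) {δ : ℝ}
    (ht : e.target = box m δ)
    (h : ∀ y ∈ e.target, coordVec e y 0 = u (e.symm y) ∧ ∀ a : Fin m, g.comp e y 0 a.succ = 0) :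
    IsAdapted δ (g.comp e) where
  smooth i j := by
    rw [← ht]
    exact contDiffOn_comp g he i j
  symm := comp_symm g e
  zero_zero y hy := by
    rw [← ht] at hy
    unfold LorentzMetric.comp
    rw [Matrix.of_apply, (h y hy).1, hu.2]
  zero_succ y hy := by
    rw [← ht] at hy
    exact (h y hy).2
  posDef y hy := by
    rw [← ht] at hy
    obtain ⟨h0, hs⟩ := h y hy
    refine Matrix.PosDef.of_dotProduct_mulVec_pos ?_ ?_
    · ext a b
      simp [spatial, comp_symm g e y b.succ a.succ]
    · intro x hx
      set v : Model m := slice 0 (WithLp.toLp 2 x) with hv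
      have hv0 : v ≠ 0 := by
        intro h
        apply hx
        ext a
        have := congrArg (fun w : Model m => w a.succ) h
        simpa [hv] using this
      set w := mfderiv 𝓘(ℝ, Model m) 𝓘(ℝ, Model m) e.symm y v with hw
      have hw0 : w ≠ 0 := by
        intro h
        exact hv0 (mfderiv_symm_injective he hy (h.trans (map_zero _).symm))
      have hwsum : w = ∑ a : Fin m, x a • coordVec e y a.succ := by
        rw [hw, mfderiv_symm_eq_sum, Fin.sum_univ_succ]
        simp [hv]
      have huw : g.val (e.symm y) (u (e.symm y)) w = 0 := by
        rw [hwsum, map_sum, ← h0]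
        refine Finset.sum_eq_zero fun a _ => ?_
        rw [map_smul]
        have := hs a
        unfold LorentzMetric.comp at this
        rw [Matrix.of_apply] at this
        rw [this, smul_zero]
      have hpos := g.pos_of_orthogonal (by rw [hu.2]; norm_num) huw hw0
      have hval : g.val (e.symm y) w w =
          dotProduct (star x) (Matrix.mulVec (spatial (g.comp e) y) x) := by
        rw [hwsum]
        simp only [map_sum, map_smul, sum_apply, smul_apply, smul_eq_mul, dotProduct,
          Matrix.mulVec, spatial, LorentzMetric.comp, Matrix.of_apply, star_trivial,
          Finset.mul_sum]
        rw [Finset.sum_comm]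
        exact Finset.sum_congr rfl fun a _ => Finset.sum_congr rfl fun b _ => by ring
      rw [← hval]
      exact hpos

/-- Around each point there are coordinates in which the metric is warped, the torse-forming field
is `∂ₜ`, and it is an eigenvector of the Ricci tensor. -/
lemma exists_warped_chart (g : LorentzMetric m M) (hm : 2 ≤ m) {u : Field m M} {φ ξ : M → ℝ}
    (hu : IsUnitTimelike g u) (hφ : IsSmoothFun (m := m) φ) (htf : IsTorseForming g u φ)
    (hev : IsRicciEigenvector g u ξ) (p : M) :
    ∃ e ∈ charts m M, p ∈ e.source ∧ ∃ (δ : ℝ) (f : ℝ → ℝ), e.target = box m δ ∧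
      ContDiffOn ℝ ∞ f (Ioo (-δ) δ) ∧ IsWarped δ (g.comp e) (fun y => φ (e.symm y)) f ∧
      ∀ y ∈ e.target, ∀ j, g.ricci e 0 j y = ξ (e.symm y) * g.comp e y 0 j := by
  obtain ⟨e, he, hpe, δ, hδ, ht, h⟩ := exists_adapted_chart g hu (fun e he y hy k j => by
    rw [htf e he y hy, htf e he y hy, comp_symm g e y k j]
    ring) p
  have hA := isAdapted_comp g hu he ht h
  have hlow : ∀ y ∈ box m δ, ∀ j, g.lower u e j y = g.comp e y 0 j := fun y hy j =>
    lower_eq_comp g (h y (by rwa [ht])).1 j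
  have hT : IsTorseAdapted δ (g.comp e) (fun y => φ (e.symm y)) :=
    { hA with
      smooth_phi := by
        rw [← ht, ← contMDiffOn_iff_contDiffOn]
        exact hφ.comp_contMDiffOn (contMDiffOn_symm_of_mem_charts he)
      pd_zero := by
        intro y hy a b
        -- Since `u_a = 0` and `u_0 = -1`, the spatial part of `∇u` is `Γ⁰_ab = ½ ∂ₜ g_ab`, which
        -- the equation sets equal to `φ g_ab`.
        have h1 := htf e he y (by rwa [ht]) a.succ b.succ
        have h2 : pd a.succ (g.lower u e b.succ) y = 0 :=
          pd_eq_zero_of_eqOn_const (isOpen_box δ)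
            (fun z hz => (hlow z hz b.succ).trans (hA.zero_succ z hz b)) hy _
        unfold LorentzMetric.nabla at h1
        rw [h2, Fin.sum_univ_succ] at h1
        simp only [hlow y hy, hA.zero_zero y hy, hA.zero_succ y hy, mul_zero,
          Finset.sum_const_zero, hA.christoffel_zero_succ_succ hy] at h1
        linarith }
  have hev' : ∀ y ∈ e.target, ∀ j, g.ricci e 0 j y = ξ (e.symm y) * g.comp e y 0 j := by
    intro y hy j
    have h1 := hev e he y hy j
    rw [ht] at hy
    have h2 : ∀ i, g.upper u e i y = if i = 0 then 1 else 0 := by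
      intro i
      unfold LorentzMetric.upper
      simp only [hlow y hy]
      rw [Fin.sum_univ_succ, hA.zero_zero y hy]
      simp only [hA.zero_succ y hy, mul_zero, Finset.sum_const_zero, add_zero]
      refine Fin.cases ?_ (fun a => ?_) i
      · simp [hA.inv_zero_zero hy]
      · simp [hA.inv_succ_zero hy, Fin.succ_ne_zero a]
    simp only [h2, ite_mul, one_mul, zero_mul, Finset.sum_ite_eq', Finset.mem_univ, if_true] at h1
    rw [h1, hlow y hy]
  have hpd : ∀ y ∈ box m δ, ∀ a : Fin m, pd a.succ (fun y => φ (e.symm y)) y = 0 := by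
    intro y hy a
    have h1 := hT.ricci_zero_succ hy a
    have h2 := hev' y (by rwa [ht]) a.succ
    unfold LorentzMetric.ricci at h2
    rw [h2, hA.zero_succ y hy, mul_zero] at h1
    have h3 : (1 - m : ℝ) ≠ 0 := by
      have : (2 : ℝ) ≤ m := by exact_mod_cast hm
      linarith
    exact (mul_eq_zero.1 h1.symm).resolve_left h3
  obtain ⟨f, hfs, hfpos, hf0, hfd, hfG⟩ := hT.exists_warp hδ hpd
  exact ⟨e, he, hpe, δ, f, ht, hfs,
    { hT with
      pos := hδ
      pd_succ := hpd
      warp_pos := hfpos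
      warp_zero := hf0
      hasDerivAt_warp := hfd
      eq_warp := hfG }, hev'⟩

/-- A space-time with a unit time-like torse-forming eigenvector of the Ricci tensor is locally a
warped product. -/
lemma isGRW_of_torseForming (g : LorentzMetric m M) (hm : 2 ≤ m) {u : Field m M} {φ ξ : M → ℝ}
    (hu : IsUnitTimelike g u) (hφ : IsSmoothFun (m := m) φ) (htf : IsTorseForming g u φ)
    (hev : IsRicciEigenvector g u ξ) : IsGRW g := by
  intro p
  obtain ⟨e, he, hpe, δ, f, ht, hfs, hW, -⟩ := exists_warped_chart g hm hu hφ htf hev p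
  have hmem : ∀ x ∈ Metric.ball (0 : EuclideanSpace ℝ (Fin m)) δ, slice 0 x ∈ box m δ :=
    fun x hx => slice_mem_box (zero_mem_Ioo hW.pos) hx
  refine ⟨e, he, hpe, -δ, δ, Metric.ball 0 δ, f, fun x => spatial (g.comp e) (slice 0 x),
    Metric.isOpen_ball, ht, hfs, fun t _ => hW.warp_pos t, fun a b => ?_,
    fun x hx => hW.posDef _ (hmem x hx), fun y hy => ?_⟩
  · exact (hW.smooth a.succ b.succ).comp
      (contDiff_slice.comp (contDiff_const.prodMk contDiff_id)).contDiffOn hmem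
  · rw [ht] at hy
    exact ⟨hW.zero_zero y hy, fun a => ⟨hW.zero_succ y hy a, hW.toIsAdapted.succ_zero hy a⟩,
      fun a b => hW.eq_warp y hy a b⟩

/-! ### The quasi-Einstein part of the Ricci tensor and the vanishing of `φ`. -/

/-- The tensor `β A ⊗ A + γ (A ⊗ B + B ⊗ A)`. -/
def quasiTensor (β γ : ℝ) {n : ℕ} (A B : Fin n → ℝ) : Matrix (Fin n) (Fin n) ℝ :=
  Matrix.of fun i j => β * (A i * A j) + γ * (A i * B j + A j * B i)

lemma quasiTensor_symm (β γ : ℝ) {n : ℕ} (A B : Fin n → ℝ) (i j : Fin n) :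
    quasiTensor β γ A B i j = quasiTensor β γ A B j i := by
  simp only [quasiTensor, Matrix.of_apply]
  ring

/-- Raising an index gives an operator with image in the span of `a` and `b`, acting there by the
matrix with rows `(β, γ)` and `(γ, 0)`; the trace of its square is `β² + 2γ²`. This is the invariant
to be compared at different times. -/
lemma trace_sq_quasiTensor (β γ : ℝ) {n : ℕ} {A B a b : Fin n → ℝ}
    {G : Matrix (Fin n) (Fin n) ℝ} (hG : IsUnit G.det) (hA : ∀ i, A i = ∑ j, G i j * a j)
    (hB : ∀ i, B i = ∑ j, G i j * b j) (haA : ∑ i, a i * A i = 1) (hbB : ∑ i, b i * B i = 1)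
    (haB : ∑ i, a i * B i = 0) (hbA : ∑ i, b i * A i = 0) :
    ((G⁻¹ * quasiTensor β γ A B) * (G⁻¹ * quasiTensor β γ A B)).trace =
      β ^ 2 + 2 * γ ^ 2 := by
  have hinv : ∀ {C c : Fin n → ℝ}, (∀ i, C i = ∑ j, G i j * c j) →
      ∀ i, ∑ l, G⁻¹ i l * C l = c i := by
    intro C c hC i
    have h1 : C = G.mulVec c := funext hC
    have h2 : G⁻¹.mulVec C = c := by
      rw [h1, Matrix.mulVec_mulVec, Matrix.nonsing_inv_mul _ hG, Matrix.one_mulVec]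
    exact congrFun h2 i
  have hN : ∀ i j, (G⁻¹ * quasiTensor β γ A B) i j =
      a i * (β * A j + γ * B j) + b i * (γ * A j) := by
    intro i j
    rw [Matrix.mul_apply, ← hinv hA i, ← hinv hB i, Finset.sum_mul, Finset.sum_mul,
      ← Finset.sum_add_distrib]
    refine Finset.sum_congr rfl fun l _ => ?_
    simp only [quasiTensor, Matrix.of_apply]
    ring
  have haX : ∑ i, a i * (β * A i + γ * B i) = β := by
    have : ∀ i, a i * (β * A i + γ * B i) = β * (a i * A i) + γ * (a i * B i) := fun i => by ring
    simp only [this, Finset.sum_add_distrib, ← Finset.mul_sum, haA, haB]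
    ring
  have hbX : ∑ i, b i * (β * A i + γ * B i) = γ := by
    have : ∀ i, b i * (β * A i + γ * B i) = β * (b i * A i) + γ * (b i * B i) := fun i => by ring
    simp only [this, Finset.sum_add_distrib, ← Finset.mul_sum, hbA, hbB]
    ring
  have haY : ∑ i, a i * (γ * A i) = γ := by
    have : ∀ i, a i * (γ * A i) = γ * (a i * A i) := fun i => by ring
    simp only [this, ← Finset.mul_sum, haA, mul_one]
  have hbY : ∑ i, b i * (γ * A i) = 0 := by
    have : ∀ i, b i * (γ * A i) = γ * (b i * A i) := fun i => by ring
    simp only [this, ← Finset.mul_sum, hbA, mul_zero]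
  set X : Fin n → ℝ := fun i => β * A i + γ * B i with hX
  set Y : Fin n → ℝ := fun i => γ * A i with hY
  have hrow : ∀ i, ∑ j, (G⁻¹ * quasiTensor β γ A B) i j * (G⁻¹ * quasiTensor β γ A B) j i =
      a i * X i * β + a i * Y i * γ + b i * X i * γ := by
    intro i
    have : ∀ j, (G⁻¹ * quasiTensor β γ A B) i j * (G⁻¹ * quasiTensor β γ A B) j i =
        a i * X i * (a j * X j) + a i * Y i * (b j * X j) + b i * X i * (a j * Y j) +
          b i * Y i * (b j * Y j) := by
      intro j
      rw [hN, hN]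
      ring
    simp only [this, Finset.sum_add_distrib, ← Finset.mul_sum]
    rw [haX, hbX, haY, hbY]
    ring
  simp only [Matrix.trace, Matrix.diag, Matrix.mul_apply (M := G⁻¹ * quasiTensor β γ A B), hrow,
    Finset.sum_add_distrib, ← Finset.sum_mul]
  rw [haX, haY, hbX]
  ring

/-- If `β A ⊗ A + γ (A ⊗ B + B ⊗ A)` has the time-like eigenvector `∂ₜ`, the eigenvalue is zero. -/
lemma quasiTensor_eigenvalue_eq_zero {β γ k a₀ b₀ : ℝ} (h0 : β * a₀ ^ 2 + 2 * γ * (a₀ * b₀) = -k)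
    (hA : β * a₀ + γ * b₀ = k * a₀) (hB : γ * a₀ = k * b₀) : k = 0 := by
  have h : k * (1 + a₀ ^ 2 + b₀ ^ 2) = 0 := by
    -- In the application `T(u, u)` is computed twice: it is `k g(u, u) = -k`, and through the
    -- contractions with `A` and `B` it is `k (a₀² + b₀²)`.
    linear_combination h0 - a₀ * hA - b₀ * hB
  exact (mul_eq_zero.1 h).resolve_right (by positivity)

lemma metric_eq_sum_lower (g : LorentzMetric m M) (X Y : Field m M)
    {e : OpenPartialHomeomorph M (Model m)} (he : e ∈ charts m M) {y : Model m}
    (hy : y ∈ e.target) :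
    ∑ j, chartField X e y j * g.lower Y e j y = g.val (e.symm y) (Y (e.symm y)) (X (e.symm y)) := by
  rw [← mfderiv_symm_chartField (X := X) he hy, mfderiv_symm_eq_sum, map_sum]
  refine Finset.sum_congr rfl fun j _ => ?_
  rw [map_smul]
  rfl

lemma lower_eq_sum_comp (g : LorentzMetric m M) (X : Field m M)
    {e : OpenPartialHomeomorph M (Model m)} (he : e ∈ charts m M) {y : Model m}
    (hy : y ∈ e.target) (i : Fin (m + 1)) :
    g.lower X e i y = ∑ j, g.comp e y i j * chartField X e y j := by
  unfold LorentzMetric.lower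
  rw [g.symm', ← mfderiv_symm_chartField (X := X) he hy, mfderiv_symm_eq_sum, map_sum]
  refine Finset.sum_congr rfl fun j _ => ?_
  rw [map_smul, mul_comm]
  rfl

/-- A generalized quasi-Einstein space-time whose constants `β`, `γ` are not both zero admits only
parallel unit time-like torse-forming eigenvectors of the Ricci tensor. -/
lemma phi_eq_zero_of_quasiEinstein (g : LorentzMetric m M) {α β γ : ℝ} {A B : Field m M}
    (hAB : IsOrthonormalPair g A B)
    (hR : ∀ e ∈ charts m M, ∀ y ∈ e.target, ∀ i j : Fin (m + 1),
      g.ricci e i j y = α * g.comp e y i j + β * (g.lower A e i y * g.lower A e j y) +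
        γ * (g.lower A e i y * g.lower B e j y + g.lower A e j y * g.lower B e i y))
    (hq : β ^ 2 + 2 * γ ^ 2 ≠ 0) {u : Field m M} {φ ξ : M → ℝ}
    (hu : IsUnitTimelike g u) (hφ : IsSmoothFun (m := m) φ) (htf : IsTorseForming g u φ)
    (hev : IsRicciEigenvector g u ξ) (p : M) : φ p = 0 := by
  have hm := two_le_of_orthonormalPair g hAB hu p
  obtain ⟨e, he, hpe, δ, f, ht, -, hW, hR0⟩ := exists_warped_chart g hm hu hφ htf hev p
  obtain ⟨-, -, hA1, hB1, hAB0⟩ := hAB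
  set T : Model m → Matrix (Fin (m + 1)) (Fin (m + 1)) ℝ := fun y =>
    quasiTensor β γ (fun i => g.lower A e i y) (fun i => g.lower B e i y) with hT
  have hRT : ∀ y ∈ box m δ, ∀ i j, ricciOf (g.comp e) i j y = α * g.comp e y i j + T y i j := by
    intro y hy i j
    have h1 := hR e he y (by rwa [ht]) i j
    unfold LorentzMetric.ricci at h1
    rw [h1]
    simp only [hT, quasiTensor, Matrix.of_apply]
    ring
  have haA : ∀ y ∈ box m δ, ∑ j, chartField A e y j * g.lower A e j y = 1 := fun y hy => by
    rw [metric_eq_sum_lower g A A he (by rwa [ht]), hA1]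
  have hbB : ∀ y ∈ box m δ, ∑ j, chartField B e y j * g.lower B e j y = 1 := fun y hy => by
    rw [metric_eq_sum_lower g B B he (by rwa [ht]), hB1]
  have haB : ∀ y ∈ box m δ, ∑ j, chartField A e y j * g.lower B e j y = 0 := fun y hy => by
    rw [metric_eq_sum_lower g A B he (by rwa [ht]), g.symm', hAB0]
  have hbA : ∀ y ∈ box m δ, ∑ j, chartField B e y j * g.lower A e j y = 0 := fun y hy => by
    rw [metric_eq_sum_lower g B A he (by rwa [ht]), hAB0]
  have hlA := fun y (hy : y ∈ box m δ) => lower_eq_sum_comp g A he (y := y) (by rwa [ht])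
  have hlB := fun y (hy : y ∈ box m δ) => lower_eq_sum_comp g B he (y := y) (by rwa [ht])
  have hT0 : ∀ y ∈ box m δ, ∀ j, T y 0 j = 0 := by
    intro y hy
    set k := ξ (e.symm y) - α with hk
    have hTk : ∀ j, T y 0 j = k * g.comp e y 0 j := by
      intro j
      have h1 := hRT y hy 0 j
      have h2 := hR0 y (by rwa [ht]) j
      unfold LorentzMetric.ricci at h2
      rw [hk]
      linarith
    set a₀ := g.lower A e 0 y with ha₀
    set b₀ := g.lower B e 0 y with hb₀
    have hTj : ∀ j, T y 0 j = β * a₀ * g.lower A e j y + γ * a₀ * g.lower B e j y +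
        γ * b₀ * g.lower A e j y := by
      intro j
      simp only [hT, quasiTensor, Matrix.of_apply]
      ring
    -- The eigenvector equation `T(u, ·) = k g(u, ·)` contracted with an arbitrary vector, to be
    -- used for `A` and `B`.
    have hcontr : ∀ c : Fin (m + 1) → ℝ, (β * a₀ + γ * b₀) * ∑ j, c j * g.lower A e j y +
        γ * a₀ * ∑ j, c j * g.lower B e j y = k * ∑ j, g.comp e y 0 j * c j := by
      intro c
      rw [Finset.mul_sum, Finset.mul_sum, Finset.mul_sum, ← Finset.sum_add_distrib]
      refine Finset.sum_congr rfl fun j _ => ?_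
      have h1 := (hTj j).symm.trans (hTk j)
      linear_combination c j * h1
    have e1 := hcontr (chartField A e y)
    have e2 := hcontr (chartField B e y)
    rw [haA y hy, haB y hy, ← hlA y hy] at e1
    rw [hbA y hy, hbB y hy, ← hlB y hy] at e2
    have e0 := (hTj 0).symm.trans (hTk 0)
    rw [hW.zero_zero y hy, ← ha₀, ← hb₀] at e0
    have hk0 : k = 0 := quasiTensor_eigenvalue_eq_zero (β := β) (γ := γ) (a₀ := a₀) (b₀ := b₀)
      (by linear_combination e0) (by linear_combination e1) (by linear_combination e2)
    intro j
    rw [hTk, hk0, zero_mul]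
  have hT0' : ∀ y ∈ box m δ, ∀ j, T y j 0 = 0 := fun y hy j =>
    (quasiTensor_symm _ _ _ _ _ _).trans (hT0 y hy j)
  have htr : ∀ y ∈ box m δ, (((g.comp e y)⁻¹ * T y) * ((g.comp e y)⁻¹ * T y)).trace =
      β ^ 2 + 2 * γ ^ 2 := by
    intro y hy
    have hdet : IsUnit (g.comp e y).det := by
      rw [isUnit_iff_ne_zero]
      intro h0
      -- The inverse of a singular matrix is `0` by convention, which contradicts the entry `-1`.
      have h1 := hW.toIsAdapted.inv_zero_zero hy
      rw [Matrix.nonsing_inv_apply_not_isUnit _ (by rw [h0]; exact not_isUnit_zero)] at h1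
      norm_num at h1
    exact trace_sq_quasiTensor β γ hdet (hlA y hy) (hlB y hy) (haA y hy) (hbB y hy) (haB y hy)
      (hbA y hy)
  -- The trace has the same nonzero value at `y` and `base y`, so its scaling factor is `1`.
  have hf : ∀ y ∈ box m δ, f (y 0) ^ 4 = 1 := by
    intro y hy
    have h1 := hW.trace_sq_scaling hT0 hT0' (fun y hy => hW.static_of_ricci_eq (by omega) hRT
      (fun z hz => hT0 z hz 0) hy) hy
    rw [htr _ (base_mem_box hW.pos hy), htr y hy] at h1
    exact (mul_right_cancel₀ hq (by rw [one_mul]; exact h1)).symm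
  have h1 := hW.phi_eq_zero hf (y := e p) (by rw [← ht]; exact e.map_source hpe)
  rwa [e.left_inv hpe] at h1

end Assembly

end GRW

theorem mainTheorem2 (m : ℕ) (M : Type*) [TopologicalSpace M]
    [ChartedSpace (GRW.Model m) M] [IsManifold 𝓘(ℝ, GRW.Model m) ∞ M]
    (g : GRW.LorentzMetric m M)
    (hg : GRW.IsGeneralizedQuasiEinstein g)
    (hu : GRW.AdmitsNontrivialTorseForming g) :
    (GRW.IsEinstein g ∧ GRW.IsGRW g) ∨ (GRW.IsPerfectFluid g ∧ GRW.IsGRW g) := by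
  obtain ⟨α, β, γ, A, B, hAB, hR⟩ := hg
  obtain ⟨u, φ, ξ, hut, hφ, -, htf, hev, hne⟩ := hu
  obtain ⟨p, hp⟩ := Function.ne_iff.1 hne
  have hm := GRW.two_le_of_orthonormalPair g hAB hut p
  -- As `β` and `γ` are global constants, the one point `p` with `φ p ≠ 0` is enough to make both
  -- vanish, and the Einstein constant is `α`.
  refine Or.inl ⟨⟨α, fun e he y hy i j => ?_⟩, GRW.isGRW_of_torseForming g hm hut hφ htf hev⟩
  have hq : β ^ 2 + 2 * γ ^ 2 = 0 := by
    by_contra hq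
    exact hp (GRW.phi_eq_zero_of_quasiEinstein g hAB hR hq hut hφ htf hev p)
  have hβ : β = 0 := pow_eq_zero_iff two_ne_zero |>.1 (by nlinarith [sq_nonneg β, sq_nonneg γ])
  have hγ : γ = 0 := pow_eq_zero_iff two_ne_zero |>.1 (by nlinarith [sq_nonneg β, sq_nonneg γ])
  rw [hR e he y hy, hβ, hγ]
  ring
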